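/- Let $\Gamma$ be a connected finite compact metric graph: finitely many edges $E_n=[0,\ell_n]$, $0<\ell_n<\infty$, at least one of them, whose endpoints are joined together at vertices, every vertex being a class of a partition of the set of all endpoints (loops and multiple edges are allowed). Some of the vertices of degree one are declared Dirichlet vertices; all other vertices are called standard. Let $L(\Gamma)=-\frac{d^2}{dx^2}$ be the Laplacian in $L_2(\Gamma)=\bigoplus_n L_2(E_n)$ whose domain consists of all $u\in\bigoplus_n W_2^2(E_n)$ such that $u=0$ at every Dirichlet vertex and, at every standard vertex, $u$ is continuous and the sum of the derivatives of $u$ at the endpoints forming the vertex, taken in the directions pointing inside the edges, is zero (Kirchhoff condition). An eigenfunction of $L(\Gamma)$ and its eigenvalue are called generic if the eigenvalue is simple and the eigenfunction does not vanish at any standard vertex. Suppose that $\Gamma$ is a tree or that there is at least one Dirichlet vertex. Then there exist an infinite sequence of generic eigenvalues $\lambda_1<\lambda_2<\cdots$ of $L(\Gamma)$ and corresponding generic eigenfunctions $\psi_1,\psi_2,\dots$ such that every $\psi_j$ attains (real) positive values at all standard vertices. -/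

import Mathlib

open MeasureTheory Set

noncomputable section

/-- A metric graph formed from compact edges indexed by `E`, with vertices `V`. The edge `e` is the
interval `[0, length e]`. Its endpoints are `(e, false)`, the point `0`, and `(e, true)`, the point
`length e`. The vertices are the classes of a partition of the set of all endpoints, given
by the surjective map `vertex`. Loops and multiple edges are allowed. Some vertices
of degree one are marked as Dirichlet vertices; all other vertices are standard. -/
structure MetricGraph (E V : Type*) where
  length : E → ℝ
  length_pos : ∀ e, 0 < length e
  vertex : E × Bool → V
  vertex_surjective : Function.Surjective vertex
  dirichlet : Set V
  dirichlet_degree_one : ∀ m ∈ dirichlet, ∃! j, vertex j = m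

/-- `u` belongs to the Sobolev space `W_2^2` of the interval `[0, l]`, with first and second
derivatives `u'` and `u''`: the function `u''` is square integrable, `u'` is a primitive
of `u''` and `u` is a primitive of `u'`. -/
structure IsW22 (l : ℝ) (u u' u'' : ℝ → ℂ) : Prop where
  memLp : MemLp u'' 2 (volume.restrict (Icc 0 l))
  eq_integral : ∀ x ∈ Icc 0 l, u x = u 0 + ∫ t in 0..x, u' t
  deriv_eq_integral : ∀ x ∈ Icc 0 l, u' x = u' 0 + ∫ t in 0..x, u'' t

namespace IsW22

variable {l : ℝ} {u u' u'' v v' v'' : ℝ → ℂ}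

theorem integrableOn (h : IsW22 l u u' u'') : IntegrableOn u'' (Icc 0 l) volume :=
  h.memLp.integrable (by norm_num)

theorem continuousOn_deriv (h : IsW22 l u u' u'') : ContinuousOn u' (Icc 0 l) := by
  by_cases hl : 0 ≤ l
  · have h1 : ContinuousOn (fun x => ∫ t in 0..x, u'' t) (Icc 0 l) := by
      have := intervalIntegral.continuousOn_primitive_interval (μ := volume) (f := u'')
        (a := 0) (b := l) (by rw [uIcc_of_le hl]; exact h.integrableOn)
      rwa [uIcc_of_le hl] at this
    exact (continuousOn_const.add h1).congr h.deriv_eq_integral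
  · rw [Icc_eq_empty hl]; exact continuousOn_empty _

theorem intervalIntegrable_deriv (h : IsW22 l u u' u'') {x : ℝ} (hx : x ∈ Icc 0 l) :
    IntervalIntegrable u' volume 0 x :=
  (h.continuousOn_deriv.mono (by
    rw [uIcc_of_le hx.1]; exact Icc_subset_Icc_right hx.2)).intervalIntegrable

theorem intervalIntegrable_deriv2 (h : IsW22 l u u' u'') {x : ℝ} (hx : x ∈ Icc 0 l) :
    IntervalIntegrable u'' volume 0 x := by
  rw [intervalIntegrable_iff_integrableOn_Icc_of_le hx.1]
  exact h.integrableOn.mono_set (Icc_subset_Icc_right hx.2)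

theorem continuousOn (h : IsW22 l u u' u'') : ContinuousOn u (Icc 0 l) := by
  by_cases hl : 0 ≤ l
  · have h1 : ContinuousOn (fun x => ∫ t in 0..x, u' t) (Icc 0 l) := by
      have := intervalIntegral.continuousOn_primitive_interval (μ := volume) (f := u')
        (a := 0) (b := l) (by
          rw [uIcc_of_le hl]; exact h.continuousOn_deriv.integrableOn_Icc)
      rwa [uIcc_of_le hl] at this
    exact (continuousOn_const.add h1).congr h.eq_integral
  · rw [Icc_eq_empty hl]; exact continuousOn_empty _

theorem zero : IsW22 l 0 0 0 where
  memLp := MemLp.zero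
  eq_integral := by simp
  deriv_eq_integral := by simp

theorem add (hu : IsW22 l u u' u'') (hv : IsW22 l v v' v'') :
    IsW22 l (u + v) (u' + v') (u'' + v'') where
  memLp := hu.memLp.add hv.memLp
  eq_integral x hx := by
    simp only [Pi.add_apply]
    rw [intervalIntegral.integral_add (hu.intervalIntegrable_deriv hx)
      (hv.intervalIntegrable_deriv hx), hu.eq_integral x hx, hv.eq_integral x hx]
    ring
  deriv_eq_integral x hx := by
    simp only [Pi.add_apply]
    rw [intervalIntegral.integral_add (hu.intervalIntegrable_deriv2 hx)
      (hv.intervalIntegrable_deriv2 hx), hu.deriv_eq_integral x hx, hv.deriv_eq_integral x hx]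
    ring

theorem smul (c : ℂ) (hu : IsW22 l u u' u'') : IsW22 l (c • u) (c • u') (c • u'') where
  memLp := hu.memLp.const_smul c
  eq_integral x hx := by
    simp only [Pi.smul_apply, smul_eq_mul, intervalIntegral.integral_const_mul]
    rw [hu.eq_integral x hx]; ring
  deriv_eq_integral x hx := by
    simp only [Pi.smul_apply, smul_eq_mul, intervalIntegral.integral_const_mul]
    rw [hu.deriv_eq_integral x hx]; ring

/-- The second derivative is determined almost everywhere by the class of `u`. -/
theorem deriv2_ae_zero (hl : 0 < l) (h : IsW22 l u u' u'')
    (h0 : u =ᵐ[volume.restrict (Icc 0 l)] 0) : u'' =ᵐ[volume.restrict (Icc 0 l)] 0 := by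
  have e0 : EqOn u 0 (Icc 0 l) :=
    Measure.eqOn_Icc_of_ae_eq volume hl.ne h0 h.continuousOn continuousOn_const
  have step : ∀ w w' : ℝ → ℂ, IntervalIntegrable w' volume 0 l →
      (∀ x ∈ Icc 0 l, w x = w 0 + ∫ t in 0..x, w' t) → EqOn w 0 (Icc 0 l) →
      w' =ᵐ[volume.restrict (Icc 0 l)] 0 := by
    intro w w' hi hw hz
    have h2 := hi.ae_hasDerivAt_integral
    rw [uIcc_of_le hl.le] at h2
    rw [← restrict_Ioo_eq_restrict_Icc]
    refine (ae_restrict_iff' measurableSet_Ioo).2 ?_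
    filter_upwards [h2] with x hx hxm
    have hd := hx (Ioo_subset_Icc_self hxm) 0 (left_mem_Icc.2 hl.le)
    have hc : (fun y => ∫ t in (0:ℝ)..y, w' t) =ᶠ[nhds x] fun _ => (0 : ℂ) := by
      filter_upwards [Ioo_mem_nhds hxm.1 hxm.2] with y hy
      have := hw y (Ioo_subset_Icc_self hy)
      rw [hz (Ioo_subset_Icc_self hy), hz (left_mem_Icc.2 hl.le)] at this
      simpa using this.symm
    exact hd.unique ((hasDerivAt_const x (0 : ℂ)).congr_of_eventuallyEq hc)
  have hlm : l ∈ Icc 0 l := right_mem_Icc.2 hl.le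
  have e1 : EqOn u' 0 (Icc 0 l) :=
    Measure.eqOn_Icc_of_ae_eq volume hl.ne
      (step u u' (h.intervalIntegrable_deriv hlm) h.eq_integral e0)
      h.continuousOn_deriv continuousOn_const
  exact step u' u'' (h.intervalIntegrable_deriv2 hlm) h.deriv_eq_integral e1

end IsW22

namespace MetricGraph

/-- The discrete graph underlying `Γ`, with loops deleted and parallel edges identified. -/
def simpleGraph {E V : Type*} (Γ : MetricGraph E V) : SimpleGraph V where
  Adj v w := v ≠ w ∧ ∃ e b, Γ.vertex (e, b) = v ∧ Γ.vertex (e, !b) = w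
  symm := ⟨fun _ _ ⟨hne, e, b, hv, hw⟩ => ⟨hne.symm, e, !b, hw, by simpa using hv⟩⟩
  loopless := ⟨fun _ h => h.1 rfl⟩

/-- The metric graph is connected. -/
def Connected {E V : Type*} (Γ : MetricGraph E V) : Prop := Γ.simpleGraph.Connected

/-- The metric graph is a tree: it is connected and it has no cycle. In particular it has
no loop and no pair of parallel edges. -/
def IsTree {E V : Type*} (Γ : MetricGraph E V) : Prop :=
  (∀ e, Γ.vertex (e, false) ≠ Γ.vertex (e, true)) ∧
  (Function.Injective fun e => s(Γ.vertex (e, false), Γ.vertex (e, true))) ∧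
  Γ.simpleGraph.IsTree

/-- The coordinate of an endpoint on its edge. -/
def position {E V : Type*} (Γ : MetricGraph E V) (j : E × Bool) : ℝ :=
  if j.2 then Γ.length j.1 else 0

/-- The value of a function on the edges at an endpoint. -/
def endpointValue {E V : Type*} (Γ : MetricGraph E V) (u : E → ℝ → ℂ) (j : E × Bool) : ℂ :=
  u j.1 (Γ.position j)

/-- The derivative at an endpoint in the direction pointing inside the edge, for a function with
derivative `u'`. -/
def inwardDeriv {E V : Type*} (Γ : MetricGraph E V) (u' : E → ℝ → ℂ) (j : E × Bool) : ℂ :=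
  if j.2 then -u' j.1 (Γ.position j) else u' j.1 (Γ.position j)

open Classical in
/-- `u`, with edgewise derivatives `u'` and `u''`, belongs to `W_2^2` on every edge, satisfies
the standard (continuity and Kirchhoff) conditions at all standard vertices, and vanishes
at all Dirichlet vertices. -/
structure IsInDomain {E V : Type*} [Fintype E] (Γ : MetricGraph E V)
    (u u' u'' : E → ℝ → ℂ) : Prop where
  isW22 : ∀ e, IsW22 (Γ.length e) (u e) (u' e) (u'' e)
  continuous_at_vertex : ∀ m ∉ Γ.dirichlet, ∀ i j, Γ.vertex i = m → Γ.vertex j = m →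
    Γ.endpointValue u i = Γ.endpointValue u j
  kirchhoff : ∀ m ∉ Γ.dirichlet, ∑ j with Γ.vertex j = m, Γ.inwardDeriv u' j = 0
  eq_zero_of_dirichlet : ∀ j, Γ.vertex j ∈ Γ.dirichlet → Γ.endpointValue u j = 0

/-- The Hilbert space `L_2(Γ)`, the orthogonal sum of the spaces `L_2` of the edges. -/
abbrev L2 {E V : Type*} (Γ : MetricGraph E V) : Type _ :=
  PiLp 2 fun e => Lp ℂ 2 (volume.restrict (Icc 0 (Γ.length e)))

variable {E V : Type*} [Fintype E]

/-- The graph of the Laplacian `-d²/dx²`, as a subspace of `L_2(Γ) × L_2(Γ)`. -/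
def laplacianGraph (Γ : MetricGraph E V) : Submodule ℂ (Γ.L2 × Γ.L2) where
  carrier := {p | ∃ u u' u'' : E → ℝ → ℂ, Γ.IsInDomain u u' u'' ∧
    ∀ e, p.1 e =ᵐ[volume.restrict (Icc 0 (Γ.length e))] u e ∧
      p.2 e =ᵐ[volume.restrict (Icc 0 (Γ.length e))] -u'' e}
  zero_mem' := by
    refine ⟨0, 0, 0, ⟨fun e => IsW22.zero, ?_, ?_, ?_⟩, fun e => ⟨?_, ?_⟩⟩
    · simp [endpointValue]
    · simp [inwardDeriv]
    · simp [endpointValue]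
    · exact Lp.coeFn_zero ℂ 2 (volume.restrict (Icc 0 (Γ.length e)))
    · simpa using Lp.coeFn_zero ℂ 2 (volume.restrict (Icc 0 (Γ.length e)))
  add_mem' := by
    rintro p q ⟨u, u', u'', hu, hp⟩ ⟨v, v', v'', hv, hq⟩
    refine ⟨u + v, u' + v', u'' + v'', ⟨fun e => (hu.isW22 e).add (hv.isW22 e), ?_, ?_, ?_⟩,
      fun e => ⟨?_, ?_⟩⟩
    · intro m hm i j hi hj
      have h1 := hu.continuous_at_vertex m hm i j hi hj
      have h2 := hv.continuous_at_vertex m hm i j hi hj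
      simp only [endpointValue, Pi.add_apply] at h1 h2 ⊢
      rw [h1, h2]
    · intro m hm
      have h : ∀ j, Γ.inwardDeriv (u' + v') j = Γ.inwardDeriv u' j + Γ.inwardDeriv v' j := by
        intro j
        simp only [inwardDeriv, Pi.add_apply]
        split_ifs <;> ring
      simp only [h, Finset.sum_add_distrib, hu.kirchhoff m hm, hv.kirchhoff m hm, add_zero]
    · intro j hj
      have h1 := hu.eq_zero_of_dirichlet j hj
      have h2 := hv.eq_zero_of_dirichlet j hj
      simp only [endpointValue, Pi.add_apply] at h1 h2 ⊢
      rw [h1, h2, add_zero]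
    · exact (Lp.coeFn_add (p.1 e) (q.1 e)).trans ((hp e).1.add (hq e).1)
    · refine (Lp.coeFn_add (p.2 e) (q.2 e)).trans (((hp e).2.add (hq e).2).trans ?_)
      exact Filter.Eventually.of_forall fun x => by simp; ring
  smul_mem' := by
    rintro c p ⟨u, u', u'', hu, hp⟩
    refine ⟨c • u, c • u', c • u'', ⟨fun e => (hu.isW22 e).smul c, ?_, ?_, ?_⟩,
      fun e => ⟨?_, ?_⟩⟩
    · intro m hm i j hi hj
      have h1 := hu.continuous_at_vertex m hm i j hi hj
      simp only [endpointValue, Pi.smul_apply] at h1 ⊢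
      rw [h1]
    · intro m hm
      have h : ∀ j, Γ.inwardDeriv (c • u') j = c * Γ.inwardDeriv u' j := by
        intro j
        simp only [inwardDeriv, Pi.smul_apply, smul_eq_mul]
        split_ifs <;> ring
      simp only [h, ← Finset.mul_sum, hu.kirchhoff m hm, mul_zero]
    · intro j hj
      have h1 := hu.eq_zero_of_dirichlet j hj
      simp only [endpointValue, Pi.smul_apply] at h1 ⊢
      rw [h1, smul_zero]
    · exact (Lp.coeFn_smul c (p.1 e)).trans ((hp e).1.const_smul c)
    · refine (Lp.coeFn_smul c (p.2 e)).trans (((hp e).2.const_smul c).trans ?_)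
      exact Filter.Eventually.of_forall fun x => by simp

/-- The Laplacian `-d²/dx²` in `L_2(Γ)` with standard and Dirichlet vertex conditions, as an
unbounded operator. -/
def laplacian (Γ : MetricGraph E V) : Γ.L2 →ₗ.[ℂ] Γ.L2 := Γ.laplacianGraph.toLinearPMap

/-- The subspace used to define the Laplacian is the graph of an operator. -/
theorem laplacian_graph (Γ : MetricGraph E V) : Γ.laplacian.graph = Γ.laplacianGraph := by
  refine Submodule.toLinearPMap_graph_eq _ ?_
  rintro ⟨p, q⟩ ⟨u, u', u'', hu, hp⟩ h0
  simp only at h0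
  subst h0
  ext1 e
  have h1 : u e =ᵐ[volume.restrict (Icc 0 (Γ.length e))] 0 :=
    (hp e).1.symm.trans (Lp.coeFn_zero ℂ 2 (volume.restrict (Icc 0 (Γ.length e))))
  have h2 := (hu.isW22 e).deriv2_ae_zero (Γ.length_pos e) h1
  refine Lp.ext ((hp e).2.trans ((h2.neg).trans ?_))
  simpa using (Lp.coeFn_zero ℂ 2 (volume.restrict (Icc 0 (Γ.length e)))).symm

/-- The eigenspace of the Laplacian: all `ψ` in its domain with `L ψ = μ ψ`. -/
def eigenspace (Γ : MetricGraph E V) (μ : ℂ) : Submodule ℂ Γ.L2 :=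
  Γ.laplacian.graph.comap (LinearMap.id.prod (μ • LinearMap.id))

/-- `u` is a continuous representative of `ψ` on every closed edge. -/
def IsContinuousRep (Γ : MetricGraph E V) (ψ : Γ.L2) (u : E → ℝ → ℂ) : Prop :=
  ∀ e, ContinuousOn (u e) (Icc 0 (Γ.length e)) ∧
    ψ e =ᵐ[volume.restrict (Icc 0 (Γ.length e))] u e

/-- `μ` is a simple eigenvalue of the Laplacian. -/
def IsSimpleEigenvalue (Γ : MetricGraph E V) (μ : ℝ) : Prop :=
  Module.finrank ℂ (Γ.eigenspace μ) = 1

/-- `ψ` is a generic eigenfunction with eigenvalue `μ`: the eigenvalue is simple, and the (continuous)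
eigenfunction does not vanish at any vertex other than the Dirichlet vertices. -/
def IsGenericEigenfunction (Γ : MetricGraph E V) (μ : ℝ) (ψ : Γ.L2) : Prop :=
  Γ.IsSimpleEigenvalue μ ∧ ψ ≠ 0 ∧ ψ ∈ Γ.eigenspace μ ∧
    ∃ u, Γ.IsContinuousRep ψ u ∧ ∀ j, Γ.vertex j ∉ Γ.dirichlet → Γ.endpointValue u j ≠ 0

/-- The (continuous) function `ψ` attains real positive values at all vertices other than the
Dirichlet vertices. -/
def IsPositiveAtVertices (Γ : MetricGraph E V) (ψ : Γ.L2) : Prop :=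
  ∃ u, Γ.IsContinuousRep ψ u ∧ ∀ j, Γ.vertex j ∉ Γ.dirichlet →
    ∃ r : ℝ, 0 < r ∧ Γ.endpointValue u j = (r : ℂ)

end MetricGraph

end

/-! On an edge, a solution of `-u'' = k ^ 2 u` is `a cos (k x) + b sin (k x)`, so an eigenfunction
with eigenvalue `k ^ 2 > 0` is a solution of a finite real linear system that depends only on the
angles `k * length e` modulo `2π`. By `HasPositiveMode.exists_eigenfunction` it suffices to find
arbitrarily large `k` for which this system has a one-dimensional solution space, spanned by a
solution positive at the standard vertices. Integers `n` exist for which all `n * length e` are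
simultaneously close to multiples of `2π`; then `k = n + s` has nearly the angles `s * length e`. A
bounded range of `s` therefore suffices, provided the argument tolerates small errors in the angles.

With a Dirichlet vertex, the angles of the positive ground state are imitated. For angles in `(0,
π)` the vertex values determine the edge functions, and the vertex conditions describe the kernel of
the Dirichlet-to-Neumann form. This form is positive for small angles and takes a negative value
when an angle at a standard vertex nears `π`. At its first degeneration it is still nonnegative. Its
off-diagonal part is nonpositive, so a Perron–Frobenius argument makes its kernel one-dimensional
and spanned by a function positive at all standard vertices. An edge between two Dirichlet vertices
escapes the argument, but then it is the whole graph.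

On a tree without Dirichlet vertices, the constant function at angle zero is imitated. The angles
may now vanish or differ in sign, so the form above is singular. In terms of the half-angle tangents
`t`, vertex values and edge flows satisfy a linear system that is regular at `t = 0`. Allowing a
common Kirchhoff defect at all vertices and normalizing the sum of the values makes this system
square. On a tree it is invertible at `t = 0`, since a tree carries no circulating flow, and hence
for all small `t`, with vertex values near `1`. The defect has the sign of the angles when they all
have one sign, so the intermediate value theorem in `s` makes it vanish. -/

noncomputable section

/-! ### Solutions of the edge equation -/

/-- The solution `A cos (k x) + B sin (k x)` of `-u'' = k ^ 2 u`. -/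
def wave (k : ℝ) (A B : ℂ) (x : ℝ) : ℂ := A * (Real.cos (k * x) : ℂ) + B * (Real.sin (k * x) : ℂ)

theorem hasDerivAt_wave (k : ℝ) (A B : ℂ) (x : ℝ) :
    HasDerivAt (wave k A B) (k * wave k B (-A) x) x := by
  have h0 : HasDerivAt (fun x : ℝ => k * x) k x := by
    simpa using (hasDerivAt_id x).const_mul k
  have h := ((h0.cos.ofReal_comp).const_mul A).add ((h0.sin.ofReal_comp).const_mul B)
  refine h.congr_deriv ?_
  simp only [wave]
  push_cast
  ring

theorem continuous_wave (k : ℝ) (A B : ℂ) : Continuous (wave k A B) :=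
  continuous_iff_continuousAt.2 fun x => (hasDerivAt_wave k A B x).continuousAt

theorem wave_zero (k : ℝ) (A B : ℂ) : wave k A B 0 = A := by simp [wave]

theorem wave_smul (k : ℝ) (c A B : ℂ) (x : ℝ) :
    wave k (c * A) (c * B) x = c * wave k A B x := by simp only [wave]; ring

theorem wave_neg (k : ℝ) (A B : ℂ) (x : ℝ) : wave k (-A) (-B) x = -wave k A B x := by
  simp only [wave]; ring

theorem memLp_wave (l k : ℝ) (A B : ℂ) :
    MemLp (wave k A B) 2 (volume.restrict (Icc 0 l)) := by
  obtain ⟨C, hC⟩ := isCompact_Icc.exists_bound_of_continuousOn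
    (continuous_wave k A B).continuousOn (s := Icc 0 l)
  exact MemLp.of_bound (continuous_wave k A B).aestronglyMeasurable C
    ((ae_restrict_iff' measurableSet_Icc).2 (Filter.Eventually.of_forall hC))

theorem isW22_wave (l k : ℝ) (A B : ℂ) :
    IsW22 l (wave k A B) (fun x => k * wave k B (-A) x) (fun x => -(k : ℂ) ^ 2 * wave k A B x) where
  memLp := (memLp_wave l k A B).const_mul _
  eq_integral x _ := by
    rw [intervalIntegral.integral_eq_sub_of_hasDerivAt (fun y _ => hasDerivAt_wave k A B y)]
    · ring
    · exact (continuous_const.mul (continuous_wave k B (-A))).intervalIntegrable _ _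
  deriv_eq_integral x _ := by
    rw [intervalIntegral.integral_eq_sub_of_hasDerivAt (f := fun x => k * wave k B (-A) x)]
    · ring
    · intro y _
      refine ((hasDerivAt_wave k B (-A) y).const_mul (k : ℂ)).congr_deriv ?_
      rw [wave_neg]; ring
    · exact (continuous_const.mul (continuous_wave k A B)).intervalIntegrable _ _

/-- The `W_2^2` solutions of `-u'' = k ^ 2 u` are the functions `wave k A B`. -/
theorem IsW22.eqOn_wave {l k : ℝ} {u u' u'' : ℝ → ℂ} (h : IsW22 l u u' u'') (hl : 0 < l)
    (hk : k ≠ 0)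
    (hu : u'' =ᵐ[volume.restrict (Icc 0 l)] fun x => -(k : ℂ) ^ 2 * u x) :
    EqOn u (wave k (u 0) (u' 0 / k)) (Icc 0 l) ∧
      EqOn u' (fun x => k * wave k (u' 0 / k) (-u 0) x) (Icc 0 l) := by
  have hkc : (k : ℂ) ≠ 0 := by exact_mod_cast hk
  -- The continuous extension of `u` gives primitives `w'` and `w` that are differentiable on the
  -- whole line and agree with `u'` and `u` on the interval.
  let v : ℝ → ℂ := Set.IccExtend hl.le ((Icc 0 l).domRestrict u)
  have hv : Continuous v := h.continuousOn.domRestrict.Icc_extend'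
  have hvu : ∀ x ∈ Icc 0 l, v x = u x := fun x hx => by
    simp [v, IccExtend_of_mem hl.le _ hx, Set.domRestrict]
  let w' : ℝ → ℂ := fun x => u' 0 + ∫ t in 0..x, -(k : ℂ) ^ 2 * v t
  have hw' : ∀ x, HasDerivAt w' (-(k : ℂ) ^ 2 * v x) x := fun x =>
    ((continuous_const.mul hv).integral_hasStrictDerivAt 0 x).hasDerivAt.const_add _
  let w : ℝ → ℂ := fun x => u 0 + ∫ t in 0..x, w' t
  have hw'c : Continuous w' := continuous_iff_continuousAt.2 fun x => (hw' x).continuousAt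
  have hw : ∀ x, HasDerivAt w (w' x) x := fun x =>
    (hw'c.integral_hasStrictDerivAt 0 x).hasDerivAt.const_add _
  have e1 : ∀ x ∈ Icc 0 l, u' x = w' x := by
    intro x hx
    rw [h.deriv_eq_integral x hx]
    refine congrArg (u' 0 + ·) (intervalIntegral.integral_congr_ae ?_)
    have := (ae_restrict_iff' measurableSet_Icc).1 hu
    filter_upwards [this] with t ht htx
    rw [uIoc_of_le hx.1] at htx
    have htm : t ∈ Icc 0 l := ⟨htx.1.le, htx.2.trans hx.2⟩
    rw [ht htm, hvu t htm]
  have e0 : ∀ x ∈ Icc 0 l, u x = w x := by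
    intro x hx
    rw [h.eq_integral x hx]
    refine congrArg (u 0 + ·) (intervalIntegral.integral_congr ?_)
    intro t ht
    rw [uIcc_of_le hx.1] at ht
    exact e1 t ⟨ht.1, ht.2.trans hx.2⟩
  have hc : ∀ x : ℝ, HasDerivAt (fun y : ℝ => ((Real.cos (k * y) : ℝ) : ℂ))
      (-(k * Real.sin (k * x) : ℝ) : ℂ) x := fun x => by
    have := hasDerivAt_wave k 1 0 x
    refine (this.congr_deriv ?_).congr_of_eventuallyEq (.of_forall fun y => ?_) <;>
      simp [wave]
  have hs : ∀ x : ℝ, HasDerivAt (fun y : ℝ => ((Real.sin (k * y) : ℝ) : ℂ))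
      ((k * Real.cos (k * x) : ℝ) : ℂ) x := fun x => by
    have := hasDerivAt_wave k 0 1 x
    refine (this.congr_deriv ?_).congr_of_eventuallyEq (.of_forall fun y => ?_) <;>
      simp [wave]
  have hw0 : w 0 = u 0 := by simp [w]
  have hw'0 : w' 0 = u' 0 := by simp [w']
  -- The phase vector `(w, w' / k)`, rotated back through the angle `k x`, is constant: the
  -- derivatives of its two components contain the factor `v - w`, which vanishes on the interval.
  have c1 : ∀ x ∈ Icc 0 l,
      w x * Real.cos (k * x) - w' x / k * Real.sin (k * x) = u 0 := by
    intro x hx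
    have hd : ∀ y, HasDerivAt
        (fun x : ℝ => w x * Real.cos (k * x) - w' x / k * Real.sin (k * x))
        (k * (v y - w y) * Real.sin (k * y)) y := fun y => by
      refine (((hw y).mul (hc y)).sub (((hw' y).div_const (k : ℂ)).mul (hs y))).congr_deriv ?_
      push_cast; field_simp; ring
    have := constant_of_has_deriv_right_zero (a := 0) (b := l)
      (fun y _ => (hd y).continuousAt.continuousWithinAt) (fun y hy => by
        have hy' : y ∈ Icc 0 l := Ico_subset_Icc_self hy
        have := hd y
        rw [hvu y hy', e0 y hy', sub_self, mul_zero, zero_mul] at this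
        exact this.hasDerivWithinAt) x hx
    rw [this]; simp [hw0]
  have c2 : ∀ x ∈ Icc 0 l,
      w x * Real.sin (k * x) + w' x / k * Real.cos (k * x) = u' 0 / k := by
    intro x hx
    have hd : ∀ y, HasDerivAt
        (fun x : ℝ => w x * Real.sin (k * x) + w' x / k * Real.cos (k * x))
        (k * (w y - v y) * Real.cos (k * y)) y := fun y => by
      refine (((hw y).mul (hs y)).add (((hw' y).div_const (k : ℂ)).mul (hc y))).congr_deriv ?_
      push_cast; field_simp; ring
    have := constant_of_has_deriv_right_zero (a := 0) (b := l)
      (fun y _ => (hd y).continuousAt.continuousWithinAt) (fun y hy => by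
        have hy' : y ∈ Icc 0 l := Ico_subset_Icc_self hy
        have := hd y
        rw [hvu y hy', e0 y hy', sub_self, mul_zero, zero_mul] at this
        exact this.hasDerivWithinAt) x hx
    rw [this]; simp [hw'0]
  have sc : ∀ x : ℝ, (Real.sin (k * x) : ℂ) ^ 2 + (Real.cos (k * x) : ℂ) ^ 2 = 1 := fun x => by
    exact_mod_cast Real.sin_sq_add_cos_sq (k * x)
  refine ⟨fun x hx => ?_, fun x hx => ?_⟩
  · rw [e0 x hx, wave, ← c1 x hx, ← c2 x hx]
    linear_combination -w x * sc x
  · simp only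
    rw [e1 x hx, wave, ← c1 x hx, ← c2 x hx]
    have : (k : ℂ) * (w' x / k) = w' x := by field_simp
    linear_combination -w' x * sc x + (-(Real.sin (k * x) : ℂ) ^ 2 - (Real.cos (k * x) : ℂ) ^ 2) * this

/-! ### From modes to generic eigenfunctions -/

namespace MetricGraph

variable {E V : Type*}

/-- The value at an endpoint of the function `a cos (k x) + b sin (k x)` on the edges. -/
def modeValue (Γ : MetricGraph E V) (k : ℝ) (a b : E → ℝ) (j : E × Bool) : ℝ :=
  if j.2 then a j.1 * Real.cos (k * Γ.length j.1) + b j.1 * Real.sin (k * Γ.length j.1) else a j.1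

/-- The inward derivative, divided by `k`, at an endpoint of the function
`a cos (k x) + b sin (k x)` on the edges. -/
def modeFlux (Γ : MetricGraph E V) (k : ℝ) (a b : E → ℝ) (j : E × Bool) : ℝ :=
  if j.2 then a j.1 * Real.sin (k * Γ.length j.1) - b j.1 * Real.cos (k * Γ.length j.1) else b j.1

open Classical in
/-- The function `a cos (k x) + b sin (k x)` on the edges satisfies all vertex conditions. -/
structure IsMode [Fintype E] (Γ : MetricGraph E V) (k : ℝ) (a b : E → ℝ) : Prop where
  continuous_at_vertex : ∀ i j, Γ.vertex i = Γ.vertex j → Γ.vertex j ∉ Γ.dirichlet →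
    Γ.modeValue k a b i = Γ.modeValue k a b j
  kirchhoff : ∀ v ∉ Γ.dirichlet, ∑ j with Γ.vertex j = v, Γ.modeFlux k a b j = 0
  eq_zero_of_dirichlet : ∀ j, Γ.vertex j ∈ Γ.dirichlet → Γ.modeValue k a b j = 0

/-- The number `k` is positive and carries exactly one mode up to multiples; this mode is positive
at all standard vertices. -/
def HasPositiveMode [Fintype E] (Γ : MetricGraph E V) (k : ℝ) : Prop :=
  0 < k ∧ ∃ a b, Γ.IsMode k a b ∧ (∀ j, Γ.vertex j ∉ Γ.dirichlet → 0 < Γ.modeValue k a b j) ∧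
    (∃ e, a e ≠ 0 ∨ b e ≠ 0) ∧ ∀ a' b', Γ.IsMode k a' b' → ∃ c : ℝ, a' = c • a ∧ b' = c • b

theorem endpointValue_wave (Γ : MetricGraph E V) (k : ℝ) (A B : E → ℂ) (j : E × Bool) :
    Γ.endpointValue (fun e => wave k (A e) (B e)) j =
      Γ.modeValue k (fun e => (A e).re) (fun e => (B e).re) j +
        Γ.modeValue k (fun e => (A e).im) (fun e => (B e).im) j * Complex.I := by
  rcases j with ⟨e, _ | _⟩ <;> apply Complex.ext <;>
    simp [endpointValue, modeValue, position, wave, -Complex.ofReal_cos, -Complex.ofReal_sin]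

theorem inwardDeriv_wave (Γ : MetricGraph E V) (k : ℝ) (A B : E → ℂ) (j : E × Bool) :
    Γ.inwardDeriv (fun e x => k * wave k (B e) (-A e) x) j =
      k * Γ.modeFlux k (fun e => (A e).re) (fun e => (B e).re) j +
        k * Γ.modeFlux k (fun e => (A e).im) (fun e => (B e).im) j * Complex.I := by
  rcases j with ⟨e, _ | _⟩ <;> apply Complex.ext <;>
    simp [inwardDeriv, modeFlux, position, wave, -Complex.ofReal_cos, -Complex.ofReal_sin] <;> ring

theorem modeValue_zero (Γ : MetricGraph E V) (k : ℝ) (j : E × Bool) :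
    Γ.modeValue k (fun _ => 0) (fun _ => 0) j = 0 := by simp [modeValue]

theorem modeFlux_zero (Γ : MetricGraph E V) (k : ℝ) (j : E × Bool) :
    Γ.modeFlux k (fun _ => 0) (fun _ => 0) j = 0 := by simp [modeFlux]

variable [Fintype E]

theorem IsMode.isInDomain {Γ : MetricGraph E V} {k : ℝ} {a b : E → ℝ} (h : Γ.IsMode k a b) :
    Γ.IsInDomain (fun e => wave k (a e) (b e)) (fun e x => k * wave k (b e) (-(a e : ℂ)) x)
      (fun e x => -(k : ℂ) ^ 2 * wave k (a e) (b e) x) where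
  isW22 e := isW22_wave _ _ _ _
  continuous_at_vertex m hm i j hi hj := by
    simp only [endpointValue_wave, Complex.ofReal_re, Complex.ofReal_im, modeValue_zero]
    rw [h.continuous_at_vertex i j (hi.trans hj.symm) (hj ▸ hm)]
  kirchhoff m hm := by
    have := h.kirchhoff m hm
    simp only [inwardDeriv_wave, Complex.ofReal_re, Complex.ofReal_im, modeFlux_zero]
    simp only [Complex.ofReal_zero, mul_zero, zero_mul, add_zero, ← Finset.mul_sum]
    rw [← Complex.ofReal_sum, this]; simp
  eq_zero_of_dirichlet j hj := by
    simp [endpointValue_wave, modeValue_zero, h.eq_zero_of_dirichlet j hj]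

/-- A function in the domain of the Laplacian that solves `-u'' = k ^ 2 u` consists of two modes. -/
theorem IsInDomain.isMode {Γ : MetricGraph E V} {k : ℝ} (hk : k ≠ 0) {u u' u'' : E → ℝ → ℂ}
    (h : Γ.IsInDomain u u' u'')
    (hu : ∀ e, u'' e =ᵐ[volume.restrict (Icc 0 (Γ.length e))] fun x => -(k : ℂ) ^ 2 * u e x) :
    Γ.IsMode k (fun e => (u e 0).re) (fun e => (u' e 0 / k).re) ∧
      Γ.IsMode k (fun e => (u e 0).im) (fun e => (u' e 0 / k).im) := by
  have hkc : (k : ℂ) ≠ 0 := by exact_mod_cast hk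
  have hpos : ∀ j, Γ.position j ∈ Icc 0 (Γ.length j.1) := by
    rintro ⟨e, _ | _⟩ <;> simp [position, (Γ.length_pos e).le]
  have hw := fun e => (h.isW22 e).eqOn_wave (Γ.length_pos e) hk (hu e)
  have e0 : ∀ j, Γ.endpointValue u j =
      Γ.endpointValue (fun e => wave k (u e 0) (u' e 0 / k)) j := fun j => (hw j.1).1 (hpos j)
  have e1 : ∀ j, Γ.inwardDeriv u' j =
      Γ.inwardDeriv (fun e x => k * wave k (u' e 0 / k) (-u e 0) x) j := fun j => by
    simp only [inwardDeriv, (hw j.1).2 (hpos j)]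
  simp only [endpointValue_wave] at e0
  simp only [inwardDeriv_wave] at e1
  have r0 : ∀ x y z w : ℝ, (x + y * Complex.I = z + w * Complex.I) → x = z ∧ y = w := by
    intro x y z w hxy
    have h1 := congrArg Complex.re hxy
    have h2 := congrArg Complex.im hxy
    simpa using And.intro h1 h2
  have hc := fun i j (hij : Γ.vertex i = Γ.vertex j) (hj : Γ.vertex j ∉ Γ.dirichlet) =>
    r0 _ _ _ _ ((e0 i).symm.trans ((h.continuous_at_vertex _ hj i j hij rfl).trans (e0 j)))
  have hd := fun j (hj : Γ.vertex j ∈ Γ.dirichlet) =>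
    r0 _ _ 0 0 ((e0 j).symm.trans ((h.eq_zero_of_dirichlet j hj).trans (by simp)))
  have hq := fun v (hv : v ∉ Γ.dirichlet) => (h.kirchhoff v hv)
  simp only [e1, Finset.sum_add_distrib, ← Finset.sum_mul, ← Finset.mul_sum] at hq
  have hq' : ∀ v ∉ Γ.dirichlet, _ ∧ _ := fun v hv => by
    have h1 := hq v hv
    rw [← Complex.ofReal_sum, ← Complex.ofReal_sum, mul_assoc, ← mul_add] at h1
    exact r0 _ _ 0 0 (((mul_eq_zero.1 h1).resolve_left hkc).trans (by simp))
  exact ⟨⟨fun i j hij hj => (hc i j hij hj).1, fun v hv => (hq' v hv).1, fun j hj => (hd j hj).1⟩,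
    ⟨fun i j hij hj => (hc i j hij hj).2, fun v hv => (hq' v hv).2, fun j hj => (hd j hj).2⟩⟩

theorem mem_eigenspace_iff (Γ : MetricGraph E V) (μ : ℂ) (ψ : Γ.L2) :
    ψ ∈ Γ.eigenspace μ ↔ ∃ u u' u'' : E → ℝ → ℂ, Γ.IsInDomain u u' u'' ∧
      ∀ e, ψ e =ᵐ[volume.restrict (Icc 0 (Γ.length e))] u e ∧
        (μ • ψ) e =ᵐ[volume.restrict (Icc 0 (Γ.length e))] -u'' e := by
  rw [eigenspace, laplacian_graph]
  rfl

/-- Uniqueness among real modes suffices for complex simplicity: the real and imaginary parts of an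
eigenfunction are modes, hence real multiples `c` and `d` of the given one, and the eigenfunction is
its multiple by `c + d * I`. -/
theorem HasPositiveMode.exists_eigenfunction {Γ : MetricGraph E V} {k : ℝ}
    (h : Γ.HasPositiveMode k) :
    ∃ ψ, Γ.IsGenericEigenfunction (k ^ 2) ψ ∧ Γ.IsPositiveAtVertices ψ := by
  obtain ⟨hk, a, b, hm, hpos, ⟨e₀, he₀⟩, huniq⟩ := h
  let ψ : Γ.L2 := WithLp.toLp 2 fun e => (memLp_wave (Γ.length e) k (a e) (b e)).toLp _
  have hψ : ∀ e, ψ e =ᵐ[volume.restrict (Icc 0 (Γ.length e))] wave k (a e) (b e) :=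
    fun e => (memLp_wave (Γ.length e) k (a e) (b e)).coeFn_toLp
  have hval : ∀ j, Γ.endpointValue (fun e => wave k (a e) (b e)) j = Γ.modeValue k a b j := by
    intro j; simp [endpointValue_wave, modeValue_zero]
  have hmem : ψ ∈ Γ.eigenspace ((k ^ 2 : ℝ) : ℂ) := by
    rw [mem_eigenspace_iff]
    refine ⟨_, _, _, hm.isInDomain, fun e => ⟨hψ e, ?_⟩⟩
    refine (Lp.coeFn_smul (((k ^ 2 : ℝ) : ℂ)) (ψ e)).trans
      (((hψ e).const_smul (((k ^ 2 : ℝ) : ℂ))).trans ?_)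
    exact Filter.Eventually.of_forall fun x => by simp
  have hne : ψ ≠ 0 := by
    intro h0
    have h1 : wave k (a e₀) (b e₀) =ᵐ[volume.restrict (Icc 0 (Γ.length e₀))] 0 := by
      refine (hψ e₀).symm.trans ?_
      rw [h0]
      exact Lp.coeFn_zero ℂ 2 (volume.restrict (Icc 0 (Γ.length e₀)))
    have hl := Γ.length_pos e₀
    have h2 : EqOn (wave k (a e₀) (b e₀)) 0 (Icc 0 (Γ.length e₀)) :=
      Measure.eqOn_Icc_of_ae_eq volume hl.ne h1 (continuous_wave _ _ _).continuousOn
        continuousOn_const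
    have h3 : a e₀ = 0 := by
      have := h2 (left_mem_Icc.2 hl.le)
      rw [wave_zero] at this
      simpa using this
    have h4 : b e₀ ≠ 0 := by simpa [h3] using he₀
    have h5 := (hasDerivAt_wave k (a e₀) (b e₀) 0).hasDerivWithinAt (s := Icc 0 (Γ.length e₀))
    have h6 : HasDerivWithinAt (wave k (a e₀) (b e₀)) 0 (Icc 0 (Γ.length e₀)) 0 :=
      (hasDerivWithinAt_const 0 _ (0 : ℂ)).congr h2 (h2 (left_mem_Icc.2 hl.le))
    have h7 := (uniqueDiffOn_Icc hl 0 (left_mem_Icc.2 hl.le)).eq_deriv _ h5 h6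
    rw [wave_zero] at h7
    simp [h4, hk.ne'] at h7
  have hrep : Γ.IsContinuousRep ψ fun e => wave k (a e) (b e) :=
    fun e => ⟨(continuous_wave _ _ _).continuousOn, hψ e⟩
  refine ⟨ψ, ⟨?_, hne, hmem, _, hrep, fun j hj => ?_⟩, _, hrep, fun j hj => ⟨_, hpos j hj, hval j⟩⟩
  · rw [IsSimpleEigenvalue, finrank_eq_one_iff']
    refine ⟨⟨ψ, hmem⟩, by simpa using hne, ?_⟩
    rintro ⟨φ, hφ⟩
    obtain ⟨u, u', u'', hd, hu⟩ := (Γ.mem_eigenspace_iff _ _).1 hφ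
    have hode : ∀ e, u'' e =ᵐ[volume.restrict (Icc 0 (Γ.length e))]
        fun x => -(k : ℂ) ^ 2 * u e x := by
      intro e
      have h1 := (Lp.coeFn_smul (((k ^ 2 : ℝ) : ℂ)) (φ e)).symm.trans (hu e).2
      filter_upwards [h1, (hu e).1] with x hx hx'
      simp only [Pi.smul_apply, Pi.neg_apply, smul_eq_mul, hx'] at hx
      rw [eq_comm, neg_eq_iff_eq_neg] at hx
      rw [hx]; push_cast; ring
    obtain ⟨hre, him⟩ := hd.isMode hk.ne' hode
    obtain ⟨c, hca, hcb⟩ := huniq _ _ hre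
    obtain ⟨d, hda, hdb⟩ := huniq _ _ him
    refine ⟨(c + d * Complex.I : ℂ), Subtype.ext ?_⟩
    ext1 e
    refine Lp.ext ?_
    refine (Lp.coeFn_smul (c + d * Complex.I : ℂ) (ψ e)).trans ?_
    refine ((hψ e).const_smul (c + d * Complex.I : ℂ)).trans ?_
    refine Filter.EventuallyEq.trans ?_ (hu e).1.symm
    refine (ae_restrict_iff' measurableSet_Icc).2 (Filter.Eventually.of_forall fun x hx => ?_)
    rw [((hd.isW22 e).eqOn_wave (Γ.length_pos e) hk.ne' (hode e)).1 hx]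
    have hA : u e 0 = (c + d * Complex.I) * a e := by
      have h1 := congrFun hca e
      have h2 := congrFun hda e
      apply Complex.ext <;> simp_all
    have hB : u' e 0 / k = (c + d * Complex.I) * b e := by
      have h1 := congrFun hcb e
      have h2 := congrFun hdb e
      simp only [Pi.smul_apply, smul_eq_mul] at h1 h2
      apply Complex.ext <;> [rw [h1]; rw [h2]] <;> simp
    rw [hA, hB, wave_smul]; rfl
  · rw [hval]; exact_mod_cast (hpos j hj).ne'

theorem exists_generic_sequence (Γ : MetricGraph E V)
    (h : ∀ N : ℕ, ∃ k, (N : ℝ) ≤ k ∧ Γ.HasPositiveMode k) :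
    ∃ (lam : ℕ → ℝ) (ψ : ℕ → Γ.L2), StrictMono lam ∧
      ∀ n, Γ.IsGenericEigenfunction (lam n) (ψ n) ∧ Γ.IsPositiveAtVertices (ψ n) := by
  choose K hK hmode using h
  -- Each new value is at least `⌊k⌋₊ + 1`, hence larger than its predecessor `k`.
  let κ : ℕ → ℝ := fun n => Nat.rec (K 0) (fun _ k => K (⌊k⌋₊ + 1)) n
  have hκ : ∀ n, Γ.HasPositiveMode (κ n) := by
    intro n
    cases n <;> exact hmode _
  have hmono : StrictMono κ := strictMono_nat_of_lt_succ fun n => by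
    refine (Nat.lt_floor_add_one (κ n)).trans_le ?_
    exact_mod_cast hK (⌊κ n⌋₊ + 1)
  choose ψ hψ using fun n => (hκ n).exists_eigenfunction
  exact ⟨fun n => κ n ^ 2, ψ, fun m n hmn => pow_lt_pow_left₀ (hmono hmn) (hκ m).1.le two_ne_zero,
    hψ⟩

end MetricGraph

/-! ### Simultaneous recurrence of the angles -/

/-- Finitely many angles growing linearly return simultaneously to any neighbourhood of zero. -/
theorem exists_nat_near_int_mul_two_pi {E : Type*} [Finite E] (l : E → ℝ) {δ : ℝ} (hδ : 0 < δ)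
    (N : ℕ) : ∃ n : ℕ, N ≤ n ∧ ∀ e, ∃ m : ℤ, |n * l e - m * (2 * Real.pi)| < δ := by
  cases nonempty_fintype E
  have : Fact (0 < 2 * Real.pi) := ⟨Real.two_pi_pos⟩
  -- The multiples of a point of the compact torus `(ℝ / 2πℤ) ^ E` accumulate at zero.
  have h := mapClusterPt_zero_atTop_nsmul (fun e => (l e : AddCircle (2 * Real.pi)))
  have h1 := (mapClusterPt_iff_frequently.1 h _ (Metric.ball_mem_nhds 0 hδ))
  obtain ⟨n, hn, hn'⟩ := Filter.frequently_atTop.1 h1 N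
  refine ⟨n, hn, fun e => ⟨round ((2 * Real.pi)⁻¹ * (n * l e)), ?_⟩⟩
  rw [← AddCircle.norm_eq]
  rw [mem_ball_zero_iff, pi_norm_lt_iff hδ] at hn'
  have := hn' e
  rw [Pi.smul_apply, ← AddCircle.coe_nsmul, nsmul_eq_mul] at this
  exact this

/-! ### The vertex form and its kernel -/

namespace MetricGraph

variable {E V : Type*}

/-- A property that holds at one vertex and passes to adjacent vertices holds everywhere. -/
theorem Connected.induction {Γ : MetricGraph E V} (hc : Γ.Connected) {P : V → Prop} {v : V}
    (hv : P v) (h : ∀ e b, P (Γ.vertex (e, b)) → P (Γ.vertex (e, !b))) (w : V) : P w := by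
  obtain ⟨p⟩ := hc.preconnected v w
  induction p with
  | nil => exact hv
  | cons hadj _ ih =>
    obtain ⟨-, e, b, rfl, rfl⟩ := hadj
    exact ih (h e b hv)

theorem eq_of_vertex_eq_of_dirichlet {Γ : MetricGraph E V} {i j : E × Bool}
    (hij : Γ.vertex i = Γ.vertex j) (hj : Γ.vertex j ∈ Γ.dirichlet) : i = j :=
  (Γ.dirichlet_degree_one _ hj).unique hij rfl

variable [Fintype E]

/-- The quadratic form of the Dirichlet-to-Neumann map on vertex functions for edges carrying the
angles `θ`, polarized. -/
def vertexForm (Γ : MetricGraph E V) (θ : E → ℝ) (f g : V → ℝ) : ℝ :=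
  ∑ j : E × Bool, g (Γ.vertex j) * ((f (Γ.vertex j) * Real.cos (θ j.1) -
    f (Γ.vertex (j.1, !j.2))) / Real.sin (θ j.1))

theorem sum_flip (h : E × Bool → ℝ) : ∑ j : E × Bool, h (j.1, !j.2) = ∑ j, h j := by
  simp only [Fintype.sum_prod_type, Fintype.sum_bool, Bool.not_true, Bool.not_false]
  exact Finset.sum_congr rfl fun _ _ => add_comm _ _

/-- The diagonal terms are symmetric, and reversing every edge exchanges the cross terms. -/
theorem vertexForm_comm (Γ : MetricGraph E V) (θ : E → ℝ) (f g : V → ℝ) :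
    Γ.vertexForm θ f g = Γ.vertexForm θ g f := by
  have h := sum_flip fun j : E × Bool =>
    f (Γ.vertex j) * g (Γ.vertex (j.1, !j.2)) / Real.sin (θ j.1)
  simp only [Bool.not_not] at h
  rw [← sub_eq_zero, vertexForm, vertexForm, ← Finset.sum_sub_distrib, ← sub_eq_zero.2 h.symm,
    ← Finset.sum_sub_distrib]
  refine Finset.sum_congr rfl fun j _ => ?_
  ring

theorem vertexForm_add_smul (Γ : MetricGraph E V) (θ : E → ℝ) (f g : V → ℝ) (s : ℝ) :
    Γ.vertexForm θ (f + s • g) (f + s • g) =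
      Γ.vertexForm θ f f + 2 * s * Γ.vertexForm θ f g + s ^ 2 * Γ.vertexForm θ g g := by
  have h : 2 * s * Γ.vertexForm θ f g = s * Γ.vertexForm θ f g + s * Γ.vertexForm θ g f := by
    rw [vertexForm_comm Γ θ g f]; ring
  rw [h]
  simp only [vertexForm, Finset.mul_sum, ← Finset.sum_add_distrib]
  refine Finset.sum_congr rfl fun j _ => ?_
  simp only [Pi.add_apply, Pi.smul_apply, smul_eq_mul]
  ring

/-- The functions on the vertices that vanish at the Dirichlet vertices. -/
def VanishesOnDirichlet (Γ : MetricGraph E V) (f : V → ℝ) : Prop := ∀ v ∈ Γ.dirichlet, f v = 0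

open Classical in
/-- The Kirchhoff conditions in terms of the values at the vertices. -/
def IsBalanced (Γ : MetricGraph E V) (θ : E → ℝ) (f : V → ℝ) : Prop :=
  ∀ v ∉ Γ.dirichlet, ∑ j with Γ.vertex j = v, (f (Γ.vertex j) * Real.cos (θ j.1) -
    f (Γ.vertex (j.1, !j.2))) / Real.sin (θ j.1) = 0

open Classical in
theorem vertexForm_single (Γ : MetricGraph E V) (θ : E → ℝ) (f : V → ℝ) (v : V) :
    Γ.vertexForm θ f (Pi.single v 1) = ∑ j with Γ.vertex j = v,
      (f (Γ.vertex j) * Real.cos (θ j.1) - f (Γ.vertex (j.1, !j.2))) / Real.sin (θ j.1) := by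
  rw [vertexForm, Finset.sum_filter]
  refine Finset.sum_congr rfl fun j _ => ?_
  by_cases h : Γ.vertex j = v <;> simp [h]

theorem IsBalanced.vertexForm_eq_zero {Γ : MetricGraph E V} {θ : E → ℝ} {f : V → ℝ}
    (hf : Γ.IsBalanced θ f) (h0 : Γ.VanishesOnDirichlet f) : Γ.vertexForm θ f f = 0 := by
  classical
  have hV := Finite.of_surjective _ Γ.vertex_surjective
  cases nonempty_fintype V
  rw [vertexForm, ← Finset.sum_fiberwise (g := Γ.vertex)]
  refine Finset.sum_eq_zero fun v _ => ?_
  by_cases hv : v ∈ Γ.dirichlet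
  · refine Finset.sum_eq_zero fun j hj => ?_
    rw [(Finset.mem_filter.1 hj).2, h0 v hv, zero_mul]
  · rw [Finset.sum_congr rfl (g := fun j => f v * ((f (Γ.vertex j) * Real.cos (θ j.1) -
      f (Γ.vertex (j.1, !j.2))) / Real.sin (θ j.1))), ← Finset.mul_sum]
    · convert mul_zero (f v)
      convert hf v hv
    · intro j hj
      rw [(Finset.mem_filter.1 hj).2]

theorem IsBalanced.sub_smul {Γ : MetricGraph E V} {θ : E → ℝ} {f g : V → ℝ}
    (hf : Γ.IsBalanced θ f) (hg : Γ.IsBalanced θ g) (c : ℝ) : Γ.IsBalanced θ (f - c • g) := by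
  intro v hv
  have h := congrArg₂ (fun x y => x - c * y) (hf v hv) (hg v hv)
  simp only [Finset.mul_sum, ← Finset.sum_sub_distrib, mul_zero, sub_zero] at h
  refine Eq.trans (Finset.sum_congr rfl fun j _ => ?_) h
  simp only [Pi.sub_apply, Pi.smul_apply, smul_eq_mul]
  ring

/-- A zero of a nonnegative form is a minimizer, so its first variation vanishes; varying the value
at one standard vertex gives the Kirchhoff condition there. -/
theorem isBalanced_of_vertexForm_eq_zero {Γ : MetricGraph E V} {θ : E → ℝ} {f : V → ℝ}
    (hpsd : ∀ g, Γ.VanishesOnDirichlet g → 0 ≤ Γ.vertexForm θ g g)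
    (h0 : Γ.VanishesOnDirichlet f) (hf : Γ.vertexForm θ f f = 0) : Γ.IsBalanced θ f := by
  classical
  intro v hv
  rw [← vertexForm_single]
  set g : V → ℝ := Pi.single v 1
  have hg : Γ.VanishesOnDirichlet g := fun w hw => by
    have : w ≠ v := fun h => hv (h ▸ hw)
    simp [g, this]
  have key : ∀ s : ℝ, 0 ≤ 2 * s * Γ.vertexForm θ f g + s ^ 2 * Γ.vertexForm θ g g := by
    intro s
    have := hpsd (f + s • g) fun w hw => by simp [h0 w hw, hg w hw]
    rw [vertexForm_add_smul, hf] at this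
    linarith
  have hC := hpsd g hg
  set B := Γ.vertexForm θ f g
  set C := Γ.vertexForm θ g g
  -- The minimizing parameter would be `-B / C`; the added `1` keeps the denominator positive when
  -- `C = 0`.
  have h1 := key (-B / (C + 1))
  have h2 : 2 * (-B / (C + 1)) * B + (-B / (C + 1)) ^ 2 * C = -(B ^ 2 * (C + 2)) / (C + 1) ^ 2 := by
    field_simp; ring
  rw [h2, le_div_iff₀ (by positivity), zero_mul] at h1
  have h3 : B ^ 2 * (C + 2) = 0 := le_antisymm (by linarith) (by positivity)
  have h4 : C + 2 ≠ 0 := by positivity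
  simpa [h4] using h3

/-- Absolute values keep the squares and can only increase the products across edges, which enter
with the negative coefficient `-1 / sin θ`. Thus minimizers may be replaced by nonnegative ones. -/
theorem vertexForm_abs_le (Γ : MetricGraph E V) {θ : E → ℝ} (hθ : ∀ e, 0 < Real.sin (θ e))
    (f : V → ℝ) : Γ.vertexForm θ |f| |f| ≤ Γ.vertexForm θ f f := by
  refine Finset.sum_le_sum fun j _ => ?_
  rw [← mul_div_assoc, ← mul_div_assoc]
  refine div_le_div_of_nonneg_right ?_ (hθ _).le
  simp only [Pi.abs_apply]
  have h1 := abs_mul_abs_self (f (Γ.vertex j))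
  have h2 := le_abs_self (f (Γ.vertex j) * f (Γ.vertex (j.1, !j.2)))
  rw [abs_mul] at h2
  have h3 : |f (Γ.vertex j)| * |f (Γ.vertex j)| * Real.cos (θ j.1) =
    f (Γ.vertex j) * f (Γ.vertex j) * Real.cos (θ j.1) := by rw [h1]
  nlinarith

/-- A minimizer of a nonnegative vertex form that vanishes at a standard vertex is zero. -/
theorem eq_zero_of_isBalanced {Γ : MetricGraph E V} (hc : Γ.Connected) {θ : E → ℝ}
    (hθ : ∀ e, 0 < Real.sin (θ e))
    (hpsd : ∀ g, Γ.VanishesOnDirichlet g → 0 ≤ Γ.vertexForm θ g g) {f : V → ℝ}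
    (h0 : Γ.VanishesOnDirichlet f) (hf : Γ.IsBalanced θ f) {v : V} (hv : v ∉ Γ.dirichlet)
    (hfv : f v = 0) : f = 0 := by
  classical
  have ha : Γ.VanishesOnDirichlet |f| := fun w hw => by simp [h0 w hw]
  have hb : Γ.IsBalanced θ |f| := isBalanced_of_vertexForm_eq_zero hpsd ha
    (le_antisymm ((vertexForm_abs_le Γ hθ f).trans (hf.vertexForm_eq_zero h0).le) (hpsd _ ha))
  -- Where `|f|` vanishes, its Kirchhoff sum has only nonpositive terms, so each is zero and `f`
  -- vanishes at all neighbours.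
  have hnext : ∀ w ∉ Γ.dirichlet, f w = 0 → ∀ e b, Γ.vertex (e, b) = w →
      f (Γ.vertex (e, !b)) = 0 := by
    intro w hw hfw e b hew
    have h1 := hb w hw
    have h2 : ∀ j ∈ Finset.univ.filter (fun j => Γ.vertex j = w),
        (|f| (Γ.vertex j) * Real.cos (θ j.1) - |f| (Γ.vertex (j.1, !j.2))) / Real.sin (θ j.1)
          ≤ 0 := by
      intro j hj
      rw [(Finset.mem_filter.1 hj).2]
      refine div_nonpos_of_nonpos_of_nonneg ?_ (hθ _).le
      simp [hfw]
    have h3 := (Finset.sum_eq_zero_iff_of_nonpos h2).1 (by convert h1) (e, b) (by simp [hew])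
    rw [hew] at h3
    simpa [hfw, (hθ e).ne'] using h3
  -- No balance holds at a Dirichlet vertex. Its only edge is the one along which it was reached, so
  -- the second clause just remembers that the other end is already a zero.
  have hall := hc.induction (P := fun w => f w = 0 ∧
      (w ∈ Γ.dirichlet → ∀ e b, Γ.vertex (e, b) = w → f (Γ.vertex (e, !b)) = 0))
    (v := v) ⟨hfv, fun h => absurd h hv⟩ (by
      rintro e b ⟨h1, h2⟩
      have h3 : f (Γ.vertex (e, !b)) = 0 := by
        by_cases h : Γ.vertex (e, b) ∈ Γ.dirichlet
        · exact h2 h e b rfl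
        · exact hnext _ h h1 e b rfl
      refine ⟨h3, fun hD e' b' he' => ?_⟩
      obtain ⟨rfl, rfl⟩ := Prod.mk.inj (eq_of_vertex_eq_of_dirichlet he' hD)
      simpa using h1)
  funext w
  exact (hall w).1

/-- A nonnegative degenerate vertex form carries a positive mode. -/
theorem hasPositiveMode_of_vertexForm {Γ : MetricGraph E V} (hc : Γ.Connected) {k : ℝ}
    (hk : 0 < k) {θ : E → ℝ} (hθ : ∀ e, 0 < Real.sin (θ e))
    (hcos : ∀ e, Real.cos (k * Γ.length e) = Real.cos (θ e))
    (hsin : ∀ e, Real.sin (k * Γ.length e) = Real.sin (θ e))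
    (hpsd : ∀ g, Γ.VanishesOnDirichlet g → 0 ≤ Γ.vertexForm θ g g) {f : V → ℝ}
    (h0 : Γ.VanishesOnDirichlet f) (hf : Γ.vertexForm θ f f = 0) (hne : f ≠ 0) :
    Γ.HasPositiveMode k := by
  classical
  have ha : Γ.VanishesOnDirichlet |f| := fun w hw => by simp [h0 w hw]
  have hb : Γ.IsBalanced θ |f| := isBalanced_of_vertexForm_eq_zero hpsd ha
    (le_antisymm ((vertexForm_abs_le Γ hθ f).trans hf.le) (hpsd _ ha))
  have hane : |f| ≠ 0 := by simpa using hne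
  obtain ⟨v₀, hv₀'⟩ : ∃ v, f v ≠ 0 := Function.ne_iff.1 hne
  have hv₀ : v₀ ∉ Γ.dirichlet := fun h => hv₀' (h0 _ h)
  have hpos : ∀ v ∉ Γ.dirichlet, 0 < |f| v := fun v hv => by
    refine lt_of_le_of_ne (abs_nonneg (f v)) fun h => hane ?_
    exact eq_zero_of_isBalanced hc hθ hpsd ha hb hv h.symm
  generalize |f| = F at *
  have hs := fun e => (hθ e).ne'
  let slope : (V → ℝ) → E → ℝ := fun g e => (g (Γ.vertex (e, true)) -
    g (Γ.vertex (e, false)) * Real.cos (θ e)) / Real.sin (θ e)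
  let start : (V → ℝ) → E → ℝ := fun g e => g (Γ.vertex (e, false))
  have hval : ∀ g j, Γ.modeValue k (start g) (slope g) j = g (Γ.vertex j) := by
    rintro g ⟨e, _ | _⟩
    · simp [modeValue, start]
    · have := hs e
      simp only [modeValue, start, slope, hcos, hsin, if_true]
      field_simp
      ring
  have hflux : ∀ g j, Γ.modeFlux k (start g) (slope g) j = -((g (Γ.vertex j) * Real.cos (θ j.1) -
      g (Γ.vertex (j.1, !j.2))) / Real.sin (θ j.1)) := by
    rintro g ⟨e, _ | _⟩
    · simp only [modeFlux, slope, Bool.not_false]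
      simp only [Bool.false_eq_true, if_false]
      ring
    · have := hs e
      simp only [modeFlux, start, slope, hcos, hsin, if_true, Bool.not_true]
      field_simp
      linear_combination g (Γ.vertex (e, false)) * Real.sin_sq_add_cos_sq (θ e)
  refine ⟨hk, start F, slope F, ⟨?_, ?_, ?_⟩, ?_, ?_, ?_⟩
  · intro i j hij _
    rw [hval, hval, hij]
  · intro v hv
    simp only [hflux, Finset.sum_neg_distrib, neg_eq_zero]
    exact hb v hv
  · intro j hj
    rw [hval, ha _ hj]
  · intro j hj
    rw [hval]
    exact hpos _ hj
  · obtain ⟨⟨e, b⟩, rfl⟩ := Γ.vertex_surjective v₀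
    by_contra! hcon
    have h1 := hpos _ hv₀
    rw [← hval F] at h1
    simp [modeValue, hcon e] at h1
  · intro a b hm
    let g : V → ℝ := fun v => Γ.modeValue k a b (Function.surjInv Γ.vertex_surjective v)
    have hg : ∀ j, g (Γ.vertex j) = Γ.modeValue k a b j := fun j => by
      have hj := Function.surjInv_eq Γ.vertex_surjective (Γ.vertex j)
      by_cases hD : Γ.vertex j ∈ Γ.dirichlet
      · simp only [g]
        rw [hm.eq_zero_of_dirichlet j hD, hm.eq_zero_of_dirichlet _ (by rwa [hj])]
      · exact hm.continuous_at_vertex _ _ hj hD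
    have hstart : start g = a := funext fun e => by
      simp only [start, hg]; simp [modeValue]
    have hslope : slope g = b := funext fun e => by
      have := hs e
      simp only [slope, hg]
      simp only [modeValue, hcos, hsin, if_true, Bool.false_eq_true, if_false]
      field_simp
      ring
    have hg0 : Γ.VanishesOnDirichlet g := fun v hv => by
      obtain ⟨j, rfl⟩ := Γ.vertex_surjective v
      rw [hg, hm.eq_zero_of_dirichlet j hv]
    have hgb : Γ.IsBalanced θ g := fun v hv => by
      have := hm.kirchhoff v hv
      rw [← hstart, ← hslope] at this
      simpa only [hflux, Finset.sum_neg_distrib, neg_eq_zero] using this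
    have hF := (hpos v₀ hv₀).ne'
    -- Removing the multiple of `F` with the same value at `v₀` leaves a balanced function that
    -- vanishes at a standard vertex.
    have hz : g - (g v₀ / F v₀) • F = 0 := by
      refine eq_zero_of_isBalanced hc hθ hpsd (v := v₀) ?_ ?_ hv₀ ?_
      · intro v hv; simp [hg0 v hv, ha v hv]
      · exact hgb.sub_smul hb _
      · simp [hF]
    rw [sub_eq_zero] at hz
    generalize g v₀ / F v₀ = c at hz
    refine ⟨c, ?_, ?_⟩
    · rw [← hstart, hz]; rfl
    · rw [← hslope, hz]
      funext e
      simp only [slope, Pi.smul_apply, smul_eq_mul]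
      ring

end MetricGraph

/-! ### First degeneration of the form: graphs with a Dirichlet vertex -/

namespace MetricGraph

variable {E V : Type*}

/-- The vertex functions of norm one that vanish at the Dirichlet vertices. -/
def vertexSphere [Fintype V] (Γ : MetricGraph E V) : Set (V → ℝ) :=
  {f | Γ.VanishesOnDirichlet f ∧ ∑ v, f v ^ 2 = 1}

theorem sq_le_one_of_mem_vertexSphere [Fintype V] {Γ : MetricGraph E V} {f : V → ℝ}
    (hf : f ∈ Γ.vertexSphere) (v : V) : f v ^ 2 ≤ 1 := by
  rw [← hf.2]
  exact Finset.single_le_sum (f := fun v => f v ^ 2) (fun _ _ => sq_nonneg _) (Finset.mem_univ v)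

theorem isCompact_vertexSphere [Fintype V] (Γ : MetricGraph E V) : IsCompact Γ.vertexSphere := by
  refine Metric.isCompact_of_isClosed_isBounded ?_ ?_
  · have h1 : IsClosed {f : V → ℝ | Γ.VanishesOnDirichlet f} := by
      simp only [VanishesOnDirichlet, Set.ofPred_forall]
      exact isClosed_iInter fun v => isClosed_iInter fun _ =>
        isClosed_eq (continuous_apply v) continuous_const
    exact h1.inter (isClosed_eq (by fun_prop) continuous_const)
  · refine (Metric.isBounded_closedBall (x := (0 : V → ℝ)) (r := 1)).subset fun f hf => ?_
    rw [mem_closedBall_zero_iff, pi_norm_le_iff_of_nonneg zero_le_one]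
    intro v
    exact abs_le_one_iff_mul_self_le_one.2 (by
      rw [← sq]; exact sq_le_one_of_mem_vertexSphere hf v)

variable [Fintype E]

theorem vertexForm_smul_self (Γ : MetricGraph E V) (θ : E → ℝ) (f : V → ℝ) (s : ℝ) :
    Γ.vertexForm θ (s • f) (s • f) = s ^ 2 * Γ.vertexForm θ f f := by
  have := vertexForm_add_smul Γ θ 0 f s
  simpa [vertexForm] using this

theorem vertexForm_nonneg_of_sphere [Fintype V] {Γ : MetricGraph E V} {θ : E → ℝ}
    (h : ∀ f ∈ Γ.vertexSphere, 0 ≤ Γ.vertexForm θ f f) {f : V → ℝ}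
    (hf : Γ.VanishesOnDirichlet f) : 0 ≤ Γ.vertexForm θ f f := by
  by_cases h0 : f = 0
  · simp [h0, vertexForm]
  have hpos : 0 < ∑ v, f v ^ 2 := by
    obtain ⟨v, hv⟩ := Function.ne_iff.1 h0
    exact Finset.sum_pos' (fun _ _ => sq_nonneg _) ⟨v, Finset.mem_univ v, by
      have : f v ≠ 0 := hv
      positivity⟩
  set n := Real.sqrt (∑ v, f v ^ 2) with hn
  have hn0 : 0 < n := Real.sqrt_pos.2 hpos
  have hn2 : n ^ 2 = ∑ v, f v ^ 2 := Real.sq_sqrt hpos.le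
  have h1 := h (n⁻¹ • f) ⟨fun v hv => by simp [hf v hv], by
    simp only [Pi.smul_apply, smul_eq_mul, mul_pow, ← Finset.mul_sum, ← hn2]
    field_simp⟩
  rw [vertexForm_smul_self] at h1
  exact nonneg_of_mul_nonneg_right h1 (by positivity)

theorem continuousOn_vertexForm (Γ : MetricGraph E V) {η : E → ℝ} {I : Set ℝ}
    (hI : ∀ s ∈ I, ∀ e, 0 < Real.sin (η e + s * Γ.length e)) :
    ContinuousOn (fun p : ℝ × (V → ℝ) =>
      Γ.vertexForm (fun e => η e + p.1 * Γ.length e) p.2 p.2) (I ×ˢ univ) := by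
  unfold vertexForm
  refine continuousOn_finsetSum _ fun j _ => ?_
  refine ContinuousOn.mul (Continuous.continuousOn (by fun_prop)) (ContinuousOn.div
    (Continuous.continuousOn (by fun_prop)) (Continuous.continuousOn (by fun_prop)) ?_)
  rintro ⟨s, f⟩ ⟨hs, -⟩
  exact (hI s hs j.1).ne'

/-- If the vertex form is positive for `s = a` and not for `s = b`, it becomes degenerate, and still
nonnegative, in between. -/
theorem exists_degenerate_vertexForm [Fintype V] (Γ : MetricGraph E V) {η : E → ℝ} {a b : ℝ}
    (hab : a ≤ b) (hsin : ∀ s ∈ Icc a b, ∀ e, 0 < Real.sin (η e + s * Γ.length e))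
    (ha : ∀ f ∈ Γ.vertexSphere, 0 < Γ.vertexForm (fun e => η e + a * Γ.length e) f f)
    (hb : ∃ f ∈ Γ.vertexSphere, Γ.vertexForm (fun e => η e + b * Γ.length e) f f ≤ 0) :
    ∃ s ∈ Icc a b, (∀ f ∈ Γ.vertexSphere,
      0 ≤ Γ.vertexForm (fun e => η e + s * Γ.length e) f f) ∧
      ∃ f ∈ Γ.vertexSphere, Γ.vertexForm (fun e => η e + s * Γ.length e) f f = 0 := by
  set F : ℝ × (V → ℝ) → ℝ := fun p => Γ.vertexForm (fun e => η e + p.1 * Γ.length e) p.2 p.2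
  have hF : ContinuousOn F (Icc a b ×ˢ univ) := continuousOn_vertexForm Γ hsin
  have hFS : ContinuousOn F (Icc a b ×ˢ Γ.vertexSphere) :=
    hF.mono (prod_mono_right (subset_univ _))
  have hcpt := isCompact_Icc (a := a) (b := b) |>.prod Γ.isCompact_vertexSphere
  -- The parameters for which the form is nonpositive somewhere on the sphere form a compact set. At
  -- the least of them the form is a limit of nonnegative ones.
  have hK : IsCompact (Prod.fst '' (Icc a b ×ˢ Γ.vertexSphere ∩ F ⁻¹' Iic 0)) :=
    (hcpt.of_isClosed_subset (hFS.preimage_isClosed_of_isClosed hcpt.isClosed isClosed_Iic)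
      inter_subset_left).image continuous_fst
  obtain ⟨f₁, hf₁, hf₁'⟩ := hb
  obtain ⟨s, ⟨⟨s', f⟩, ⟨⟨hs, hf⟩, hle⟩, rfl⟩, hmin⟩ :=
    hK.exists_isLeast ⟨b, (b, f₁), ⟨⟨right_mem_Icc.2 hab, hf₁⟩, hf₁'⟩, rfl⟩
  simp only at hs hf hle hmin ⊢
  have has : a < s' := lt_of_le_of_ne hs.1 fun h => by
    subst h
    exact (ha f hf).not_ge hle
  have hnn : ∀ g ∈ Γ.vertexSphere, 0 ≤ F (s', g) := by
    intro g hg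
    have hcont : ContinuousWithinAt (fun t => F (t, g)) (Ico a s') s' :=
      ContinuousWithinAt.comp (f := fun t : ℝ => (t, g)) (hF (s', g) ⟨hs, trivial⟩)
        (Continuous.continuousWithinAt (by fun_prop)) fun t ht => ⟨⟨ht.1, ht.2.le.trans hs.2⟩, trivial⟩
    have hbot : (nhdsWithin s' (Ico a s')).NeBot := by
      rw [← mem_closure_iff_nhdsWithin_neBot, closure_Ico has.ne]
      exact right_mem_Icc.2 has.le
    refine ge_of_tendsto (x := nhdsWithin s' (Ico a s')) hcont.tendsto ?_
    filter_upwards [self_mem_nhdsWithin] with t ht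
    by_contra! hneg
    exact ht.2.not_ge (hmin ⟨(t, g), ⟨⟨⟨ht.1, ht.2.le.trans hs.2⟩, hg⟩, hneg.le⟩, rfl⟩)
  exact ⟨s', hs, hnn, f, hf, le_antisymm hle (hnn f hf)⟩

/-- In the presence of a Dirichlet vertex the vertex form is positive for small angles. -/
theorem exists_vertexForm_pos [Fintype V] {Γ : MetricGraph E V} (hc : Γ.Connected)
    (hD : Γ.dirichlet.Nonempty) :
    ∃ δ, 0 < δ ∧ δ ≤ 1 ∧ ∀ θ : E → ℝ, (∀ e, 0 < θ e ∧ θ e ≤ δ) →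
      ∀ f ∈ Γ.vertexSphere, 0 < Γ.vertexForm θ f f := by
  -- This energy vanishes only on constants, and the Dirichlet vertex leaves only the constant zero;
  -- compactness of the sphere then bounds it below.
  set D : (V → ℝ) → ℝ := fun f => ∑ j : E × Bool, (f (Γ.vertex j) - f (Γ.vertex (j.1, !j.2))) ^ 2
  have hDpos : ∀ f ∈ Γ.vertexSphere, 0 < D f := by
    intro f hf
    refine lt_of_le_of_ne (Finset.sum_nonneg fun _ _ => sq_nonneg _) fun h => ?_
    have h1 := (Finset.sum_eq_zero_iff_of_nonneg fun j _ => sq_nonneg _).1 h.symm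
    obtain ⟨d, hd⟩ := hD
    have h2 := hc.induction (P := fun v => f v = 0) (hf.1 d hd) fun e b hb => by
      have := h1 (e, b) (Finset.mem_univ _)
      simpa [hb] using this
    have := hf.2
    simp [h2] at this
  obtain ⟨c, hc0, hcD⟩ : ∃ c, 0 < c ∧ ∀ f ∈ Γ.vertexSphere, c ≤ D f := by
    rcases Γ.vertexSphere.eq_empty_or_nonempty with h | h
    · exact ⟨1, one_pos, by simp [h]⟩
    · obtain ⟨f, hf, hmin⟩ := Γ.isCompact_vertexSphere.exists_isMinOn h
        (f := D) (Continuous.continuousOn (by fun_prop))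
      exact ⟨D f, hDpos f hf, hmin⟩
  set n : ℝ := (Fintype.card (E × Bool) : ℝ)
  have hn : 0 ≤ n := Nat.cast_nonneg _
  -- Each of the `n` endpoints costs at most `c / (2 * n + 1)`, because `1 - cos θ ≤ θ ^ 2 / 2` and
  -- `sin θ ≥ θ / 2`; the total stays below `c`.
  refine ⟨min 1 (c / (2 * n + 1) / 2), by positivity, min_le_left _ _, fun θ hθ f hf => ?_⟩
  have hδ : ∀ e, θ e ≤ 1 ∧ θ e ≤ c / (2 * n + 1) / 2 := fun e => le_min_iff.1 (hθ e).2
  have hflip := sum_flip fun j : E × Bool => f (Γ.vertex j) * ((f (Γ.vertex j) *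
    Real.cos (θ j.1) - f (Γ.vertex (j.1, !j.2))) / Real.sin (θ j.1))
  -- Averaging the two ends of each edge completes the square.
  have h2 : 2 * Γ.vertexForm θ f f = ∑ j : E × Bool,
      ((f (Γ.vertex j) - f (Γ.vertex (j.1, !j.2))) ^ 2 -
      (f (Γ.vertex j) ^ 2 + f (Γ.vertex (j.1, !j.2)) ^ 2) * (1 - Real.cos (θ j.1))) /
        Real.sin (θ j.1) := by
    rw [two_mul, vertexForm]
    nth_rw 1 [← hflip]
    rw [← Finset.sum_add_distrib]
    refine Finset.sum_congr rfl fun j _ => ?_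
    simp only [Bool.not_not]
    ring
  have h3 : ∑ j : E × Bool, ((f (Γ.vertex j) - f (Γ.vertex (j.1, !j.2))) ^ 2 -
      c / (2 * n + 1)) ≤ 2 * Γ.vertexForm θ f f := by
    rw [h2]
    refine Finset.sum_le_sum fun j _ => ?_
    obtain ⟨hp, -⟩ := hθ j.1
    obtain ⟨hle, hle'⟩ := hδ j.1
    have hpi := Real.pi_gt_three
    have hpi4 := Real.pi_le_four
    have hs := Real.mul_le_sin hp.le (by linarith)
    have hs0 : 0 < Real.sin (θ j.1) := Real.sin_pos_of_pos_of_lt_pi hp (by linarith)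
    have hs2 : θ j.1 / 2 ≤ Real.sin (θ j.1) := by
      refine le_trans ?_ hs
      have : (1 : ℝ) / 2 ≤ 2 / Real.pi := by
        rw [div_le_div_iff₀ two_pos Real.pi_pos]; linarith
      nlinarith
    have hs1 := Real.sin_le_one (θ j.1)
    have hcs := Real.one_sub_sq_div_two_le_cos (x := θ j.1)
    have hcs1 := Real.cos_le_one (θ j.1)
    have hf1 := sq_le_one_of_mem_vertexSphere hf (Γ.vertex j)
    have hf2 := sq_le_one_of_mem_vertexSphere hf (Γ.vertex (j.1, !j.2))
    rw [le_div_iff₀ hs0]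
    have t1 : (f (Γ.vertex j) - f (Γ.vertex (j.1, !j.2))) ^ 2 * Real.sin (θ j.1) ≤
        (f (Γ.vertex j) - f (Γ.vertex (j.1, !j.2))) ^ 2 :=
      mul_le_of_le_one_right (sq_nonneg _) hs1
    have t2 : (f (Γ.vertex j) ^ 2 + f (Γ.vertex (j.1, !j.2)) ^ 2) * (1 - Real.cos (θ j.1)) ≤
        2 * (θ j.1 ^ 2 / 2) :=
      mul_le_mul (by linarith) (by linarith) (by linarith) (by norm_num)
    have t3 : 2 * (θ j.1 ^ 2 / 2) ≤ c / (2 * n + 1) * Real.sin (θ j.1) := by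
      calc 2 * (θ j.1 ^ 2 / 2) = (2 * θ j.1) * (θ j.1 / 2) := by ring
        _ ≤ _ := mul_le_mul (by linarith) hs2 (by linarith) (by positivity)
    linarith [sub_mul ((f (Γ.vertex j) - f (Γ.vertex (j.1, !j.2))) ^ 2) (c / (2 * n + 1))
      (Real.sin (θ j.1))]
  rw [Finset.sum_sub_distrib, Finset.sum_const, nsmul_eq_mul, Finset.card_univ] at h3
  have h4 := hcD f hf
  have h5 : n * (c / (2 * n + 1)) < c := by
    rw [mul_div_assoc', div_lt_iff₀ (by positivity)]
    nlinarith
  simp only [D] at h4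
  linarith

open Classical in
/-- The vertex form takes negative values if one angle is close to `π`. -/
theorem vertexForm_single_neg {Γ : MetricGraph E V} {θ : E → ℝ} {δ ε : ℝ} (hδ : 0 < δ)
    (hδ' : δ ≤ Real.pi / 2) (hεδ : ε ≤ δ)
    (hε : Fintype.card (E × Bool) / Real.sin δ * Real.sin ε < Real.cos ε) (hε0 : 0 < ε)
    (hθ : ∀ e, δ ≤ θ e ∧ θ e ≤ Real.pi - ε) {j : E × Bool} (hj : θ j.1 = Real.pi - ε) :
    Γ.vertexForm θ (Pi.single (Γ.vertex j) 1) (Pi.single (Γ.vertex j) 1) < 0 := by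
  have hsδ : 0 < Real.sin δ := Real.sin_pos_of_pos_of_lt_pi hδ (by linarith [Real.pi_pos])
  have hsε : 0 < Real.sin ε := Real.sin_pos_of_pos_of_lt_pi hε0 (by linarith [Real.pi_pos])
  have hs : ∀ e, 0 < Real.sin (θ e) := fun e =>
    Real.sin_pos_of_pos_of_lt_pi (by linarith [hθ e]) (by linarith [hθ e])
  rw [vertexForm_single, Finset.sum_filter]
  -- On the indicator of the vertex each endpoint there contributes at most the cotangent of its
  -- angle, a loop even less. The chosen one gives `-cot ε`; every other is at most `1 / sin δ`, as
  -- a positive cotangent needs an angle in `[δ, π / 2]`.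
  have hle : ∀ i : E × Bool, (if Γ.vertex i = Γ.vertex j then
      ((Pi.single (Γ.vertex j) 1 : V → ℝ) (Γ.vertex i) * Real.cos (θ i.1) -
      (Pi.single (Γ.vertex j) 1 : V → ℝ) (Γ.vertex (i.1, !i.2))) / Real.sin (θ i.1) else 0) ≤
      if i = j then -(Real.cos ε / Real.sin ε) else 1 / Real.sin δ := by
    intro i
    have hnn : (0 : ℝ) ≤ (Pi.single (Γ.vertex j) 1 : V → ℝ) (Γ.vertex (i.1, !i.2)) :=
      (Pi.single_nonneg (α := fun _ : V => ℝ)).2 zero_le_one _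
    have hb : Γ.vertex i = Γ.vertex j → ((Pi.single (Γ.vertex j) 1 : V → ℝ) (Γ.vertex i) *
        Real.cos (θ i.1) - (Pi.single (Γ.vertex j) 1 : V → ℝ) (Γ.vertex (i.1, !i.2))) /
        Real.sin (θ i.1) ≤ Real.cos (θ i.1) / Real.sin (θ i.1) := fun h => by
      refine div_le_div_of_nonneg_right ?_ (hs _).le
      rw [h, Pi.single_eq_same]
      linarith
    by_cases hij : i = j
    · subst hij
      simp only [if_true]
      refine (hb rfl).trans (le_of_eq ?_)
      rw [hj, Real.cos_pi_sub, Real.sin_pi_sub, neg_div]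
    · rw [if_neg hij]
      by_cases h : Γ.vertex i = Γ.vertex j
      · rw [if_pos h]
        refine (hb h).trans ?_
        rcases le_total (θ i.1) (Real.pi / 2) with h1 | h1
        · refine div_le_div₀ zero_le_one (Real.cos_le_one _) hsδ ?_
          exact Real.sin_le_sin_of_le_of_le_pi_div_two (by linarith) h1 (hθ _).1
        · refine (div_nonpos_of_nonpos_of_nonneg ?_ (hs _).le).trans (by positivity)
          exact Real.cos_nonpos_of_pi_div_two_le_of_le h1 (by linarith [hθ i.1])
      · rw [if_neg h]; positivity
  refine (Finset.sum_le_sum fun i _ => hle i).trans_lt ?_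
  have h1 : ∀ i : E × Bool, (if i = j then -(Real.cos ε / Real.sin ε) else 1 / Real.sin δ) ≤
      1 / Real.sin δ + if i = j then -(Real.cos ε / Real.sin ε) else 0 := by
    intro i
    split_ifs
    · have : 0 ≤ 1 / Real.sin δ := by positivity
      linarith
    · simp
  refine (Finset.sum_le_sum fun i _ => h1 i).trans_lt ?_
  rw [Finset.sum_add_distrib, Finset.sum_ite_eq' Finset.univ j, if_pos (Finset.mem_univ j),
    Finset.sum_const, nsmul_eq_mul, Finset.card_univ]
  rw [← sub_eq_add_neg, sub_neg, lt_div_iff₀ hsε, mul_one_div]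
  exact hε

/-- A graph with a Dirichlet vertex on which no edge joins two Dirichlet vertices has positive modes
with arbitrarily large `k`: the angles `k * length e` return close to those of the ground state. -/
theorem exists_hasPositiveMode_of_dirichlet {Γ : MetricGraph E V} (hc : Γ.Connected)
    (hD : Γ.dirichlet.Nonempty) (hstd : ∀ e, ∃ b, Γ.vertex (e, b) ∉ Γ.dirichlet) (N : ℕ) :
    ∃ k, (N : ℝ) ≤ k ∧ Γ.HasPositiveMode k := by
  classical
  have hV := Finite.of_surjective _ Γ.vertex_surjective
  cases nonempty_fintype V
  have hE : Nonempty E := by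
    obtain ⟨d, -⟩ := hD
    obtain ⟨j, -⟩ := Γ.vertex_surjective d
    exact ⟨j.1⟩
  have hpi := Real.pi_gt_three
  obtain ⟨δ₀, hδ₀, hδ₀1, hpos⟩ := exists_vertexForm_pos hc hD
  obtain ⟨eM, hM⟩ := Finite.exists_max Γ.length
  obtain ⟨em, hm⟩ := Finite.exists_min Γ.length
  have hL := Γ.length_pos eM
  have hl := Γ.length_pos em
  -- At `s = a` the unperturbed angles lie in `[2 * δ, δ₀ / 2]`, with `2 * δ ≤ δ₀ / 2`, so errors
  -- below `δ` keep them in `[δ, δ₀]`.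
  set a := δ₀ / (2 * Γ.length eM) with ha
  have ha0 : 0 < a := by positivity
  set δ := a * Γ.length em / 2 with hδ
  have hδ0 : 0 < δ := by positivity
  have hupper : ∀ e, a * Γ.length e ≤ δ₀ / 2 := fun e => by
    have : a * Γ.length e ≤ a * Γ.length eM := mul_le_mul_of_nonneg_left (hM e) ha0.le
    refine this.trans (le_of_eq ?_)
    rw [ha]; field_simp
  have hlower : ∀ e, 2 * δ ≤ a * Γ.length e := fun e => by
    have : a * Γ.length em ≤ a * Γ.length e := mul_le_mul_of_nonneg_left (hm e) ha0.le
    rw [hδ]; linarith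
  have hδδ₀ : 2 * δ ≤ δ₀ / 2 := (hlower em).trans (hupper em)
  obtain ⟨ε, hε0, hεδ, hε⟩ : ∃ ε, 0 < ε ∧ ε ≤ δ ∧
      Fintype.card (E × Bool) / Real.sin δ * Real.sin ε < Real.cos ε := by
    have h1 : ∀ᶠ ε in nhds (0 : ℝ),
        Fintype.card (E × Bool) / Real.sin δ * Real.sin ε < Real.cos ε := by
      refine ContinuousAt.eventually_lt (by fun_prop) (by fun_prop) ?_
      simp
    obtain ⟨r, hr, hball⟩ := Metric.eventually_nhds_iff.1 h1
    refine ⟨min δ (r / 2), by positivity, min_le_left _ _, hball ?_⟩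
    rw [Real.dist_eq, sub_zero, abs_of_pos (by positivity)]
    exact (min_le_right _ _).trans_lt (by linarith)
  obtain ⟨n, hn, hrec⟩ := exists_nat_near_int_mul_two_pi Γ.length hδ0 N
  choose m hm using hrec
  set η : E → ℝ := fun e => n * Γ.length e - m e * (2 * Real.pi) with hη
  have hη' : ∀ e, -δ < η e ∧ η e < δ := fun e => abs_lt.1 (hm e)
  obtain ⟨e₀, he₀⟩ := Finite.exists_min fun e => (Real.pi - ε - η e) / Γ.length e
  -- The first parameter at which some angle reaches `π - ε`; until then every sine is positive.
  set b := (Real.pi - ε - η e₀) / Γ.length e₀ with hb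
  have hbe : ∀ e, η e + b * Γ.length e ≤ Real.pi - ε := fun e => by
    have := (le_div_iff₀ (Γ.length_pos e)).1 (he₀ e)
    linarith
  have hbe₀ : η e₀ + b * Γ.length e₀ = Real.pi - ε := by
    rw [hb, div_mul_cancel₀ _ (Γ.length_pos e₀).ne']; ring
  have hab : a ≤ b := by
    have h1 := hupper e₀
    have h2 := hη' e₀
    rw [hb, le_div_iff₀ (Γ.length_pos e₀)]
    linarith
  have hrange : ∀ s ∈ Icc a b, ∀ e, δ ≤ η e + s * Γ.length e ∧
      η e + s * Γ.length e ≤ Real.pi - ε := fun s hs e => by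
    have hle := (Γ.length_pos e).le
    have h1 := mul_le_mul_of_nonneg_right hs.1 hle
    have h2 := mul_le_mul_of_nonneg_right hs.2 hle
    have h3 := hlower e
    have h4 := hη' e
    exact ⟨by linarith, by linarith [hbe e]⟩
  have hsin : ∀ s ∈ Icc a b, ∀ e, 0 < Real.sin (η e + s * Γ.length e) := fun s hs e =>
    Real.sin_pos_of_pos_of_lt_pi (by linarith [hrange s hs e]) (by linarith [hrange s hs e])
  obtain ⟨c₀, hc₀⟩ := hstd e₀
  obtain ⟨s, hs, hnn, f, hf, hf0⟩ := Γ.exists_degenerate_vertexForm hab hsin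
    (hpos _ fun e => ⟨by linarith [hrange a (left_mem_Icc.2 hab) e],
      by linarith [hupper e, hη' e]⟩)
    ⟨Pi.single (Γ.vertex (e₀, c₀)) 1, ⟨fun v hv =>
      Pi.single_eq_of_ne (ne_of_mem_of_not_mem hv hc₀) _, by
      simp [Pi.single_apply]⟩, (vertexForm_single_neg (j := (e₀, c₀)) hδ0 (by linarith) hεδ hε hε0
        (hrange b (right_mem_Icc.2 hab)) hbe₀).le⟩
  have hangle : ∀ e, (n + s) * Γ.length e =
      η e + s * Γ.length e + m e * (2 * Real.pi) := fun e => by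
    simp only [hη]; ring
  have hNn : (N : ℝ) ≤ n := by exact_mod_cast hn
  have hs0 : 0 < s := ha0.trans_le hs.1
  refine ⟨n + s, by linarith, hasPositiveMode_of_vertexForm hc (by positivity) (hsin s hs)
    (fun e => ?_) (fun e => ?_) (fun g hg => vertexForm_nonneg_of_sphere hnn hg) hf.1 hf0 ?_⟩
  · rw [hangle, Real.cos_add_int_mul_two_pi]
  · rw [hangle, Real.sin_add_int_mul_two_pi]
  · rintro rfl
    simpa using hf.2

/-- If an edge joins two Dirichlet vertices, it is the whole graph. -/
theorem exists_hasPositiveMode_of_edge {Γ : MetricGraph E V} (hc : Γ.Connected) (e₀ : E)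
    (he₀ : ∀ b, Γ.vertex (e₀, b) ∈ Γ.dirichlet) (N : ℕ) :
    ∃ k, (N : ℝ) ≤ k ∧ Γ.HasPositiveMode k := by
  have hall := hc.induction (P := fun v => ∃ b, Γ.vertex (e₀, b) = v) ⟨false, rfl⟩
    (by
      rintro e b ⟨c, h⟩
      obtain ⟨rfl, rfl⟩ := Prod.mk.inj (eq_of_vertex_eq_of_dirichlet h.symm (he₀ c))
      exact ⟨_, rfl⟩)
  have hdir : ∀ v, v ∈ Γ.dirichlet := fun v => by
    obtain ⟨b, rfl⟩ := hall v
    exact he₀ b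
  have huniq : ∀ e, e = e₀ := fun e => by
    obtain ⟨b, hb⟩ := hall (Γ.vertex (e, false))
    exact (Prod.mk.inj (eq_of_vertex_eq_of_dirichlet hb (hdir _))).1.symm
  have hl := Γ.length_pos e₀
  -- The added `1` makes `k` positive even for `N = 0`.
  obtain ⟨n, hn⟩ := exists_nat_ge ((N + 1) * Γ.length e₀ / Real.pi)
  set k := n * Real.pi / Γ.length e₀ with hk
  have hNk : (N : ℝ) + 1 ≤ k := by
    rw [hk, le_div_iff₀ hl]
    exact (div_le_iff₀ Real.pi_pos).1 hn
  have hN0 : (0 : ℝ) ≤ N := Nat.cast_nonneg N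
  have hkl : ∀ e, Real.sin (k * Γ.length e) = 0 := fun e => by
    rw [huniq e, hk, div_mul_cancel₀ _ hl.ne', Real.sin_nat_mul_pi]
  -- The mode is `sin (k x)`; with no standard vertices, continuity, Kirchhoff conditions and
  -- positivity are vacuous.
  refine ⟨k, by linarith, by linarith, fun _ => 0, fun _ => 1,
    ⟨fun _ j _ h => absurd (hdir _) h, fun v h => absurd (hdir v) h, fun j _ => ?_⟩,
    fun j h => absurd (hdir _) h, ⟨e₀, by simp⟩, fun a b hm => ⟨b e₀, ?_, ?_⟩⟩
  · simp [modeValue, hkl]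
  · funext e
    simpa [modeValue] using hm.eq_zero_of_dirichlet (e, false) (hdir _)
  · funext e
    simp [huniq e]

end MetricGraph

/-! ### Perturbation of the constant function: trees without Dirichlet vertices -/

namespace MetricGraph

variable {E V : Type*}

/-- The differences of a vertex function along the edges. -/
def difference (Γ : MetricGraph E V) : (V → ℝ) →ₗ[ℝ] E → ℝ where
  toFun f e := f (Γ.vertex (e, true)) - f (Γ.vertex (e, false))
  map_add' f g := by funext e; simp only [Pi.add_apply]; ring
  map_smul' c f := by funext e; simp only [Pi.smul_apply, smul_eq_mul, RingHom.id_apply]; ring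

theorem Connected.eq_of_difference_eq_zero {Γ : MetricGraph E V} (hc : Γ.Connected) {f : V → ℝ}
    (hf : Γ.difference f = 0) (v w : V) : f v = f w := by
  refine hc.induction (P := fun u => f v = f u) rfl (fun e b h => ?_) w
  have he : f (Γ.vertex (e, true)) = f (Γ.vertex (e, false)) := sub_eq_zero.1 (congrFun hf e)
  cases b
  · exact h.trans he.symm
  · exact h.trans he

variable [Fintype E]

theorem IsTree.card_eq [Fintype V] {Γ : MetricGraph E V} (h : Γ.IsTree) :
    Fintype.card E + 1 = Fintype.card V := by
  classical
  obtain ⟨hloop, hinj, htree⟩ := h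
  rw [← htree.card_edgeFinset, SimpleGraph.edgeFinset_card]
  have hmem : ∀ e, s(Γ.vertex (e, false), Γ.vertex (e, true)) ∈ Γ.simpleGraph.edgeSet := fun e =>
    ⟨hloop e, e, false, rfl, rfl⟩
  have hbij : Function.Bijective fun e : E =>
      (⟨s(Γ.vertex (e, false), Γ.vertex (e, true)), hmem e⟩ : Γ.simpleGraph.edgeSet) := by
    refine ⟨fun e e' h => hinj (congrArg Subtype.val h), ?_⟩
    rintro ⟨p, hp⟩
    induction p using Sym2.ind with
    | _ v w =>
      obtain ⟨-, e, b, h1, h2⟩ := hp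
      simp only at h1 h2
      subst h1 h2
      refine ⟨e, Subtype.ext ?_⟩
      cases b
      · rfl
      · exact Sym2.eq_swap
  rw [Fintype.card_of_bijective hbij]

/-- The kernel consists of constants, and a tree has one edge fewer than vertices, so the claim is
rank–nullity. -/
theorem IsTree.surjective_difference [Fintype V] {Γ : MetricGraph E V} (h : Γ.IsTree) :
    Function.Surjective Γ.difference := by
  have hc : Γ.Connected := h.2.2.connected
  rw [← LinearMap.range_eq_top]
  refine Submodule.eq_top_of_finrank_eq ?_
  have h1 := Γ.difference.finrank_range_add_finrank_ker
  have h2 : LinearMap.ker Γ.difference ≤ Submodule.span ℝ {fun _ => (1 : ℝ)} := by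
    intro f hf
    obtain ⟨v⟩ := hc.nonempty
    refine Submodule.mem_span_singleton.2 ⟨f v, funext fun w => ?_⟩
    simp [hc.eq_of_difference_eq_zero hf v w]
  have h3 := (Submodule.finrank_mono h2).trans (finrank_span_le_card (R := ℝ) {fun _ : V => (1 : ℝ)})
  have h4 : Module.finrank ℝ (LinearMap.range Γ.difference) ≤ Module.finrank ℝ (E → ℝ) :=
    Submodule.finrank_le _
  have h5 := h.card_eq
  simp only [Module.finrank_fintype_fun_eq_card, Set.toFinset_singleton,
    Finset.card_singleton] at *
  omega

/-- The flow into an edge at an endpoint, for edges with values `f` at the ends,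
half-angle tangents `t` and symmetric flows `β`. -/
def edgeFlow (Γ : MetricGraph E V) (t : E → ℝ) (f : V → ℝ) (β : E → ℝ) (j : E × Bool) : ℝ :=
  t j.1 * (f (Γ.vertex (j.1, false)) + f (Γ.vertex (j.1, true))) / 2 +
    if j.2 then -β j.1 else β j.1

open Classical in
/-- The vertex conditions in terms of values at the vertices and flows through the edges, as a
linear system bordered by one additional unknown and one normalization. -/
def flowSystem [Fintype V] (Γ : MetricGraph E V) (t : E → ℝ) :
    ((V → ℝ) × (E → ℝ) × ℝ) →ₗ[ℝ] (E → ℝ) × (V → ℝ) × ℝ where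
  toFun x := (fun e => Γ.difference x.1 e - 2 * t e * x.2.1 e,
    fun v => ∑ j with Γ.vertex j = v, Γ.edgeFlow t x.1 x.2.1 j - x.2.2, ∑ v, x.1 v)
  map_add' x y := by
    refine Prod.ext (funext fun e => ?_) (Prod.ext (funext fun v => ?_) ?_)
    · simp only [Prod.fst_add, Prod.snd_add, map_add, Pi.add_apply]; ring
    · simp only [Prod.fst_add, Prod.snd_add, Pi.add_apply]
      rw [sub_add_sub_comm, ← Finset.sum_add_distrib]
      refine congrArg (· - _) (Finset.sum_congr rfl fun j _ => ?_)
      simp only [edgeFlow, Pi.add_apply]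
      split_ifs <;> ring
    · simp [Finset.sum_add_distrib]
  map_smul' c x := by
    refine Prod.ext (funext fun e => ?_) (Prod.ext (funext fun v => ?_) ?_)
    · simp only [Prod.smul_fst, Prod.smul_snd, map_smul, Pi.smul_apply, smul_eq_mul,
        RingHom.id_apply]; ring
    · simp only [Prod.smul_fst, Prod.smul_snd, Pi.smul_apply, smul_eq_mul, RingHom.id_apply]
      rw [mul_sub, Finset.mul_sum]
      refine congrArg (· - _) (Finset.sum_congr rfl fun j _ => ?_)
      simp only [edgeFlow, Pi.smul_apply, smul_eq_mul]
      split_ifs <;> ring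
    · simp [Finset.mul_sum]

/-- The symmetric flows cancel at the two ends of each edge. For a solution with zero vertex
residuals this expresses the common defect through `t` and the vertex values, and so reveals its
sign. -/
theorem sum_flowSystem [Fintype V] (Γ : MetricGraph E V) (t : E → ℝ)
    (x : (V → ℝ) × (E → ℝ) × ℝ) :
    ∑ v, (Γ.flowSystem t x).2.1 v =
      ∑ e, t e * (x.1 (Γ.vertex (e, false)) + x.1 (Γ.vertex (e, true))) -
        Fintype.card V * x.2.2 := by
  classical
  simp only [flowSystem, LinearMap.coe_mk, AddHom.coe_mk, Finset.sum_sub_distrib,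
    Finset.sum_const, Finset.card_univ, nsmul_eq_mul]
  congr 1
  have h := Finset.sum_fiberwise Finset.univ Γ.vertex fun j => Γ.edgeFlow t x.1 x.2.1 j
  refine Eq.trans (by convert h) ?_
  simp only [Fintype.sum_prod_type, Fintype.sum_bool, edgeFlow]
  refine Finset.sum_congr rfl fun e _ => ?_
  simp only [if_true, Bool.false_eq_true, if_false]
  ring

/-- At `t = 0` summation over the vertices kills the defect, and the values are constant with sum
zero. The remaining `β` is a flow without sources; being also the difference of a potential `u`, it
has `∑ β ^ 2 = 0` by summation by parts. -/
theorem IsTree.injective_flowSystem [Fintype V] {Γ : MetricGraph E V} (h : Γ.IsTree) :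
    Function.Injective (Γ.flowSystem 0) := by
  classical
  have hc : Γ.Connected := h.2.2.connected
  have hV : Nonempty V := hc.nonempty
  have hcard : (Fintype.card V : ℝ) ≠ 0 := by exact_mod_cast Fintype.card_ne_zero
  rw [injective_iff_map_eq_zero]
  rintro ⟨f, β, g⟩ hx
  have hsum := Γ.sum_flowSystem 0 (f, β, g)
  rw [hx] at hsum
  have hg : g = 0 := by simpa [hcard] using hsum
  have h1 : Γ.difference f = 0 := by
    funext e
    have := congrFun (congrArg Prod.fst hx) e
    simpa [flowSystem] using this
  have hf : f = 0 := by
    funext v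
    have h2 : ∑ w, f w = 0 := congrArg (fun y => y.2.2) hx
    simp only [fun w => hc.eq_of_difference_eq_zero h1 w v, Finset.sum_const, Finset.card_univ,
      nsmul_eq_mul] at h2
    simpa [hcard] using h2
  have hβ : β = 0 := by
    obtain ⟨u, hu⟩ := h.surjective_difference β
    have h2 : ∀ v, ∑ j with Γ.vertex j = v, Γ.edgeFlow 0 f β j = 0 := fun v => by
      have h3 := congrFun (congrArg (fun y => y.2.1) hx) v
      simp only [flowSystem, LinearMap.coe_mk, AddHom.coe_mk, hg, sub_zero] at h3
      exact h3
    have h3 : ∑ j, u (Γ.vertex j) * Γ.edgeFlow 0 f β j = 0 := by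
      rw [← Finset.sum_fiberwise Finset.univ Γ.vertex]
      refine Finset.sum_eq_zero fun v _ => ?_
      rw [Finset.sum_congr rfl (g := fun j => u v * Γ.edgeFlow 0 f β j), ← Finset.mul_sum, h2,
        mul_zero]
      intro j hj
      rw [(Finset.mem_filter.1 hj).2]
    have h4 : ∑ e, β e ^ 2 = 0 := by
      rw [← neg_eq_zero, ← h3, Fintype.sum_prod_type, ← Finset.sum_neg_distrib]
      refine Finset.sum_congr rfl fun e _ => ?_
      have : u (Γ.vertex (e, true)) - u (Γ.vertex (e, false)) = β e := congrFun hu e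
      simp only [Fintype.sum_bool, edgeFlow, Pi.zero_apply, if_true, Bool.false_eq_true, if_false]
      rw [← this]
      ring
    funext e
    have := (Finset.sum_eq_zero_iff_of_nonneg fun e _ => sq_nonneg (β e)).1 h4 e (Finset.mem_univ e)
    simpa using this
  simp [hf, hβ, hg]

/-- A positive solution of an injective flow system with vanishing auxiliary unknown is a
positive mode. -/
theorem hasPositiveMode_of_flowSystem [Fintype V] {Γ : MetricGraph E V}
    (hD : Γ.dirichlet = ∅) (hE : Nonempty E) {k : ℝ} (hk : 0 < k) {t : E → ℝ}
    (hcos : ∀ e, Real.cos (k * Γ.length e) * (1 + t e ^ 2) = 1 - t e ^ 2)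
    (hsin : ∀ e, Real.sin (k * Γ.length e) * (1 + t e ^ 2) = 2 * t e)
    (hinj : Function.Injective (Γ.flowSystem t)) {f : V → ℝ} {β : E → ℝ} {c : ℝ}
    (hx : Γ.flowSystem t (f, β, 0) = (0, 0, c)) (hpos : ∀ v, 0 < f v) : Γ.HasPositiveMode k := by
  classical
  have hdir : ∀ v, v ∉ Γ.dirichlet := by simp [hD]
  have ht : ∀ e, 1 + t e ^ 2 ≠ 0 := fun e => by positivity
  let start : (V → ℝ) → E → ℝ := fun f e => f (Γ.vertex (e, false))
  let slope : (V → ℝ) → (E → ℝ) → E → ℝ := fun f β e => Γ.edgeFlow t f β (e, false)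
  have hval : ∀ f β, (∀ e, Γ.difference f e = 2 * t e * β e) → ∀ j,
      Γ.modeValue k (start f) (slope f β) j = f (Γ.vertex j) := by
    rintro f β h ⟨e, _ | _⟩
    · simp [modeValue, start]
    · have h1 : f (Γ.vertex (e, true)) - f (Γ.vertex (e, false)) = 2 * t e * β e := h e
      simp only [modeValue, start, slope, edgeFlow, if_true, Bool.false_eq_true, if_false]
      refine mul_right_cancel₀ (ht e) ?_
      linear_combination f (Γ.vertex (e, false)) * hcos e +
        (t e * (f (Γ.vertex (e, false)) + f (Γ.vertex (e, true))) / 2 + β e) * hsin e - h1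
  have hflux : ∀ f β, (∀ e, Γ.difference f e = 2 * t e * β e) → ∀ j,
      Γ.modeFlux k (start f) (slope f β) j = Γ.edgeFlow t f β j := by
    rintro f β h ⟨e, _ | _⟩
    · simp [modeFlux, slope]
    · have h1 : f (Γ.vertex (e, true)) - f (Γ.vertex (e, false)) = 2 * t e * β e := h e
      simp only [modeFlux, start, slope, edgeFlow, if_true, Bool.false_eq_true, if_false]
      refine mul_right_cancel₀ (ht e) ?_
      linear_combination f (Γ.vertex (e, false)) * hsin e -
        (t e * (f (Γ.vertex (e, false)) + f (Γ.vertex (e, true))) / 2 + β e) * hcos e -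
        t e * h1
  have hdiff : ∀ e, Γ.difference f e = 2 * t e * β e := fun e =>
    sub_eq_zero.1 (congrFun (congrArg Prod.fst hx) e)
  have hc : ∑ v, f v = c := congrArg (fun y => y.2.2) hx
  have hv₀ : Nonempty V := ⟨Γ.vertex (hE.some, false)⟩
  have hc0 : c ≠ 0 := by
    rw [← hc]
    exact (Finset.sum_pos (fun v _ => hpos v) Finset.univ_nonempty).ne'
  refine ⟨hk, start f, slope f β, ⟨?_, ?_, ?_⟩, ?_, ⟨hE.some, Or.inl (hpos _).ne'⟩, ?_⟩
  · intro i j hij _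
    rw [hval f β hdiff, hval f β hdiff, hij]
  · intro v _
    simp only [hflux f β hdiff]
    have := congrFun (congrArg (fun y => y.2.1) hx) v
    simp only [flowSystem, LinearMap.coe_mk, AddHom.coe_mk, sub_zero] at this
    exact this
  · exact fun j hj => absurd hj (hdir _)
  · intro j _
    rw [hval f β hdiff]
    exact hpos _
  · intro a b hm
    let h : V → ℝ := fun v => Γ.modeValue k a b (Function.surjInv Γ.vertex_surjective v)
    have hh : ∀ j, h (Γ.vertex j) = Γ.modeValue k a b j := fun j =>
      hm.continuous_at_vertex _ _ (Function.surjInv_eq Γ.vertex_surjective (Γ.vertex j)) (hdir _)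
    -- The initial slope minus the symmetric part of the flow: every mode becomes a solution of the
    -- system, so injectivity yields simplicity.
    let γ : E → ℝ := fun e =>
      b e - t e * (h (Γ.vertex (e, false)) + h (Γ.vertex (e, true))) / 2
    have hstart : start h = a := funext fun e => by simp only [start, hh]; simp [modeValue]
    have hslope : slope h γ = b := funext fun e => by simp [slope, edgeFlow, γ]
    have hdiff' : ∀ e, Γ.difference h e = 2 * t e * γ e := fun e => by
      have h0 : h (Γ.vertex (e, false)) = a e := by rw [hh]; simp [modeValue]
      have h1 : h (Γ.vertex (e, true)) = a e * Real.cos (k * Γ.length e) +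
        b e * Real.sin (k * Γ.length e) := by rw [hh]; simp [modeValue]
      have h2 : h (Γ.vertex (e, true)) * (1 + t e ^ 2) =
          a e * (1 - t e ^ 2) + b e * (2 * t e) := by
        rw [← hcos, ← hsin, h1]; ring
      change h (Γ.vertex (e, true)) - h (Γ.vertex (e, false)) = 2 * t e * (b e - _)
      rw [h0]
      linear_combination h2
    have hsys : Γ.flowSystem t (h, γ, 0) = (0, 0, ∑ v, h v) := by
      refine Prod.ext (funext fun e => sub_eq_zero.2 (hdiff' e)) (Prod.ext (funext fun v => ?_) rfl)
      have := hm.kirchhoff v (hdir v)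
      rw [← hstart, ← hslope] at this
      simp only [hflux h γ hdiff'] at this
      simp only [flowSystem, LinearMap.coe_mk, AddHom.coe_mk, sub_zero]
      exact this
    have heq : (h, γ, (0 : ℝ)) = ((∑ v, h v) / c) • (f, β, (0 : ℝ)) := by
      refine hinj ?_
      rw [map_smul, hsys, hx]
      simp [hc0]
    generalize (∑ v, h v) / c = r at heq
    have hhr : h = r • f := congrArg Prod.fst heq
    have hγr : γ = r • β := congrArg (fun y => y.2.1) heq
    refine ⟨r, ?_, ?_⟩
    · rw [← hstart, hhr]; rfl
    · rw [← hslope, hhr, hγr]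
      funext e
      simp only [slope, edgeFlow, Pi.smul_apply, smul_eq_mul, Bool.false_eq_true, if_false]
      ring

theorem continuous_flowSystem [Fintype V] (Γ : MetricGraph E V) :
    Continuous fun t => LinearMap.toContinuousLinearMap (Γ.flowSystem t) := by
  rw [continuous_clm_apply]
  rintro ⟨f, β, g⟩
  simp only [LinearMap.coe_toContinuousLinearMap', flowSystem, LinearMap.coe_mk, AddHom.coe_mk,
    edgeFlow]
  fun_prop

/-- On a tree, the flow system with small `t` has a solution close to a constant. -/
theorem IsTree.exists_flow [Fintype V] {Γ : MetricGraph E V} (h : Γ.IsTree) :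
    ∃ δ > 0, ∃ x : (E → ℝ) → (V → ℝ) × (E → ℝ) × ℝ,
      ContinuousOn x (Metric.ball 0 δ) ∧ ∀ t ∈ Metric.ball 0 δ,
        Function.Injective (Γ.flowSystem t) ∧
        Γ.flowSystem t (x t) = (0, 0, (Fintype.card V : ℝ)) ∧ ∀ v, 0 < (x t).1 v := by
  set T := fun t => LinearMap.toContinuousLinearMap (Γ.flowSystem t)
  have hT : Continuous T := Γ.continuous_flowSystem
  set y : (E → ℝ) × (V → ℝ) × ℝ := (0, 0, (Fintype.card V : ℝ))
  -- `inverse` takes the default value zero at noninvertible maps; `x` is used only where `T t` is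
  -- an equivalence, an open condition that holds at `t = 0`.
  let x : (E → ℝ) → (V → ℝ) × (E → ℝ) × ℝ := fun t => (T t).inverse y
  have hinv : ∀ t,
      (∃ e : ((V → ℝ) × (E → ℝ) × ℝ) ≃L[ℝ] ((E → ℝ) × (V → ℝ) × ℝ), (e : _ →L[ℝ] _) = T t) →
      ContinuousAt x t := by
    rintro t ⟨e, he⟩
    have h1 : ContinuousAt ContinuousLinearMap.inverse (T t) := by
      rw [← he]
      exact (contDiffAt_map_inverse (n := 0) e).continuousAt
    have h2 : ContinuousAt (fun t => (T t).inverse) t :=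
      ContinuousAt.comp (f := T) h1 hT.continuousAt
    exact h2.clm_apply continuousAt_const
  have hsol : ∀ t,
      (∃ e : ((V → ℝ) × (E → ℝ) × ℝ) ≃L[ℝ] ((E → ℝ) × (V → ℝ) × ℝ), (e : _ →L[ℝ] _) = T t) →
      Function.Injective (Γ.flowSystem t) ∧ Γ.flowSystem t (x t) = y := by
    rintro t ⟨e, he⟩
    have h1 : ∀ z, Γ.flowSystem t z = e z := fun z => (congrArg (· z) he).symm
    refine ⟨fun a b hab => e.injective (by rwa [← h1, ← h1]), ?_⟩
    simp only [h1, x, ← he, ContinuousLinearMap.inverse_equiv]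
    exact e.apply_symm_apply y
  have h0 : (∃ e : ((V → ℝ) × (E → ℝ) × ℝ) ≃L[ℝ] ((E → ℝ) × (V → ℝ) × ℝ), (e : _ →L[ℝ] _) = T 0) := by
    refine ⟨((Γ.flowSystem 0).linearEquivOfInjective h.injective_flowSystem
      (by simp; ring)).toContinuousLinearEquiv, ?_⟩
    exact ContinuousLinearMap.ext fun z => rfl
  have hx0 : x 0 = (1, 0, 0) := by
    refine (hsol 0 h0).1 ((hsol 0 h0).2.trans ?_)
    refine Prod.ext (funext fun e => ?_) (Prod.ext (funext fun v => ?_) ?_) <;>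
      simp [y, flowSystem, difference, edgeFlow]
  have hpos : ∀ᶠ t in nhds 0, ∀ v, 0 < (x t).1 v := by
    rw [Filter.eventually_all]
    intro v
    have hcont : ContinuousAt (fun t => (x t).1 v) 0 :=
      ((continuous_apply v).comp continuous_fst).continuousAt.comp (hinv 0 h0)
    refine hcont.eventually (lt_mem_nhds ?_)
    simp [hx0]
  have hrange : ∀ᶠ t in nhds 0,
      (∃ e : ((V → ℝ) × (E → ℝ) × ℝ) ≃L[ℝ] ((E → ℝ) × (V → ℝ) × ℝ), (e : _ →L[ℝ] _) = T t) := by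
    obtain ⟨e, he⟩ := h0
    exact hT.continuousAt (he ▸ e.nhds)
  obtain ⟨δ, hδ, hball⟩ := Metric.eventually_nhds_iff_ball.1 (hpos.and hrange)
  exact ⟨δ, hδ, x, fun t ht => (hinv t (hball t ht).2).continuousWithinAt,
    fun t ht => ⟨(hsol t (hball t ht).2).1, (hsol t (hball t ht).2).2, (hball t ht).1⟩⟩

/-- A tree without Dirichlet vertices has positive modes with arbitrarily large `k`: the angles
`k * length e` return close to zero, where the mode is constant. -/
theorem exists_hasPositiveMode_of_isTree {Γ : MetricGraph E V} (h : Γ.IsTree)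
    (hD : Γ.dirichlet = ∅) (N : ℕ) : ∃ k, (N : ℝ) ≤ k ∧ Γ.HasPositiveMode k := by
  have hV := Finite.of_surjective _ Γ.vertex_surjective
  cases nonempty_fintype V
  have hc : Γ.Connected := h.2.2.connected
  have hVn : Nonempty V := hc.nonempty
  have hE : Nonempty E := by
    obtain ⟨v⟩ := hc.nonempty
    obtain ⟨j, -⟩ := Γ.vertex_surjective v
    exact ⟨j.1⟩
  obtain ⟨δ, hδ, x, hxc, hx⟩ := h.exists_flow
  obtain ⟨r, hr, hrpi, htan⟩ : ∃ r > 0, r ≤ Real.pi ∧ ∀ y, |y| < r → |Real.tan (y / 2)| < δ := by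
    have h1 : ContinuousAt (fun y : ℝ => Real.tan (y / 2)) 0 :=
      ContinuousAt.comp (f := fun y : ℝ => y / 2) (Real.continuousAt_tan.2 (by simp)) (by fun_prop)
    obtain ⟨r, hr, hball⟩ := Metric.continuousAt_iff.1 h1 δ hδ
    refine ⟨min r Real.pi, lt_min hr Real.pi_pos, min_le_right _ _, fun y hy => ?_⟩
    have := hball (x := y) (by simpa using hy.trans_le (min_le_left _ _))
    simpa using this
  obtain ⟨eM, hM⟩ := Finite.exists_max Γ.length
  obtain ⟨em, hm⟩ := Finite.exists_min Γ.length
  have hL := Γ.length_pos eM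
  have hl := Γ.length_pos em
  -- The shift `s * length e` stays within `r / 2` for `|s| ≤ σ`, while at `s = ±σ` it outweighs the
  -- error `η e`, so all angles then share a sign.
  set σ := r / 2 / Γ.length eM with hσ
  have hσ0 : 0 < σ := by positivity
  -- Since `s` may be as low as `-σ`, `n` has to exceed `N` by more than `σ`.
  obtain ⟨M, hMσ⟩ := exists_nat_gt (N + σ)
  obtain ⟨n, hn, hrec⟩ := exists_nat_near_int_mul_two_pi Γ.length
    (lt_min (half_pos hr) (mul_pos hσ0 hl)) M
  choose m hrec using hrec
  set η : E → ℝ := fun e => n * Γ.length e - m e * (2 * Real.pi) with hη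
  have hη1 : ∀ e, |η e| < r / 2 := fun e => (hrec e).trans_le (min_le_left _ _)
  have hη2 : ∀ e, |η e| < σ * Γ.length e := fun e => (hrec e).trans_le
    ((min_le_right _ _).trans (mul_le_mul_of_nonneg_left (hm e) hσ0.le))
  set θ : ℝ → E → ℝ := fun s e => η e + s * Γ.length e with hθ
  have hθr : ∀ s ∈ Icc (-σ) σ, ∀ e, |θ s e| < r := fun s hs e => by
    have h1 : |s * Γ.length e| ≤ r / 2 := by
      rw [abs_mul, abs_of_pos (Γ.length_pos e)]
      refine (mul_le_mul (abs_le.2 hs) (hM e) (Γ.length_pos e).le hσ0.le).trans (le_of_eq ?_)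
      rw [hσ]; field_simp
    calc |θ s e| ≤ |η e| + |s * Γ.length e| := abs_add_le _ _
      _ < r := by linarith [hη1 e]
  have hcos : ∀ s ∈ Icc (-σ) σ, ∀ e, 0 < Real.cos (θ s e / 2) := fun s hs e => by
    have := abs_lt.1 (hθr s hs e)
    exact Real.cos_pos_of_mem_Ioo ⟨by linarith, by linarith⟩
  set t : ℝ → E → ℝ := fun s e => Real.tan (θ s e / 2) with ht
  have htball : ∀ s ∈ Icc (-σ) σ, t s ∈ Metric.ball 0 δ := fun s hs => by
    rw [mem_ball_zero_iff, pi_norm_lt_iff hδ]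
    exact fun e => htan _ (hθr s hs e)
  have htc : ContinuousOn t (Icc (-σ) σ) := continuousOn_pi.2 fun e s hs =>
    (ContinuousAt.comp (f := fun s => θ s e / 2) (Real.continuousAt_tan.2 (hcos s hs e).ne')
      (by fun_prop)).continuousWithinAt
  have hgc : ContinuousOn (fun s => (x (t s)).2.2) (Icc (-σ) σ) :=
    (continuous_snd.comp continuous_snd).comp_continuousOn (hxc.comp htc htball)
  have hsum : ∀ s ∈ Icc (-σ) σ, Fintype.card V * (x (t s)).2.2 =
      ∑ e, t s e * ((x (t s)).1 (Γ.vertex (e, false)) + (x (t s)).1 (Γ.vertex (e, true))) := by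
    intro s hs
    have h1 := Γ.sum_flowSystem (t s) (x (t s))
    rw [(hx _ (htball s hs)).2.1] at h1
    simp only [Pi.zero_apply, Finset.sum_const_zero] at h1
    linarith
  have hcard : (0 : ℝ) < Fintype.card V := by exact_mod_cast Fintype.card_pos
  have hleft : (x (t (-σ))).2.2 ≤ 0 := by
    have hs : -σ ∈ Icc (-σ) σ := ⟨le_rfl, by linarith⟩
    have h1 := hsum _ hs
    have h2 : Fintype.card V * (x (t (-σ))).2.2 ≤ 0 := by
      rw [h1]
      refine Finset.sum_nonpos fun e _ => mul_nonpos_of_nonpos_of_nonneg ?_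
        (add_pos ((hx _ (htball _ hs)).2.2 _) ((hx _ (htball _ hs)).2.2 _)).le
      have h3 := abs_lt.1 (hη2 e)
      have h4 := abs_lt.1 (hθr _ hs e)
      have h5 : θ (-σ) e ≤ 0 := by simp only [hθ]; linarith
      exact Real.tan_nonpos_of_nonpos_of_neg_pi_div_two_le (by linarith) (by linarith)
    exact nonpos_of_mul_nonpos_right h2 hcard
  have hright : 0 ≤ (x (t σ)).2.2 := by
    have hs : σ ∈ Icc (-σ) σ := ⟨by linarith, le_rfl⟩
    have h1 := hsum _ hs
    have h2 : 0 ≤ Fintype.card V * (x (t σ)).2.2 := by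
      rw [h1]
      refine Finset.sum_nonneg fun e _ => mul_nonneg ?_
        (add_pos ((hx _ (htball _ hs)).2.2 _) ((hx _ (htball _ hs)).2.2 _)).le
      have h3 := abs_lt.1 (hη2 e)
      have h4 := abs_lt.1 (hθr _ hs e)
      have h5 : 0 ≤ θ σ e := by simp only [hθ]; linarith
      exact Real.tan_nonneg_of_nonneg_of_le_pi_div_two (by linarith) (by linarith)
    exact nonneg_of_mul_nonneg_right h2 hcard
  -- A zero of the defect: there the Kirchhoff conditions hold exactly.
  obtain ⟨s, hs, hs0⟩ := intermediate_value_Icc (by linarith) hgc ⟨hleft, hright⟩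
  simp only at hs0
  have hMn : (M : ℝ) ≤ n := by exact_mod_cast hn
  have hNk : (N : ℝ) < n + s := by linarith [hs.1]
  have hangle : ∀ e, (n + s) * Γ.length e = 2 * (θ s e / 2) + m e * (2 * Real.pi) := fun e => by
    simp only [hθ, hη]; ring
  obtain ⟨hinj, hsys, hpos⟩ := hx _ (htball s hs)
  refine ⟨n + s, hNk.le, hasPositiveMode_of_flowSystem hD hE
    ((Nat.cast_nonneg N).trans_lt hNk) (t := t s) (fun e => ?_) (fun e => ?_) hinj
    (f := (x (t s)).1) (β := (x (t s)).2.1) (c := Fintype.card V) ?_ hpos⟩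
  · rw [hangle, Real.cos_add_int_mul_two_pi, Real.cos_two_mul']
    simp only [ht, Real.tan_eq_sin_div_cos]
    have := (hcos s hs e).ne'
    field_simp
    linear_combination (Real.cos (θ s e / 2) ^ 2 - Real.sin (θ s e / 2) ^ 2) *
      Real.sin_sq_add_cos_sq (θ s e / 2)
  · rw [hangle, Real.sin_add_int_mul_two_pi, Real.sin_two_mul]
    simp only [ht, Real.tan_eq_sin_div_cos]
    have := (hcos s hs e).ne'
    field_simp
    linear_combination Real.sin (θ s e / 2) * Real.sin_sq_add_cos_sq (θ s e / 2)
  · rw [← hsys, ← hs0]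

end MetricGraph

end

theorem theorem1 {E V : Type*} [Fintype E] (Γ : MetricGraph E V) (hconn : Γ.Connected)
    (h : Γ.IsTree ∨ Γ.dirichlet.Nonempty) :
    ∃ (lam : ℕ → ℝ) (ψ : ℕ → Γ.L2), StrictMono lam ∧
      ∀ n, Γ.IsGenericEigenfunction (lam n) (ψ n) ∧ Γ.IsPositiveAtVertices (ψ n) := by
  refine Γ.exists_generic_sequence fun N => ?_
  -- A tree with Dirichlet vertices falls under the first case; the tree structure matters only
  -- without them.
  by_cases hD : Γ.dirichlet.Nonempty
  · by_cases hstd : ∀ e, ∃ b, Γ.vertex (e, b) ∉ Γ.dirichlet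
    · exact MetricGraph.exists_hasPositiveMode_of_dirichlet hconn hD hstd N
    · push Not at hstd
      obtain ⟨e, he⟩ := hstd
      exact MetricGraph.exists_hasPositiveMode_of_edge hconn e he N
  · exact MetricGraph.exists_hasPositiveMode_of_isTree (h.resolve_right hD)
      (not_nonempty_iff_eq_empty.1 hD) N
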